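/- Consider the system $x_{t+1}=Ax_t+Bu_t$, $y_t=Cx_t$ with $A\in\mathbb R^{n\times n}$, $B\in\mathbb R^{n\times m}$, $C\in\mathbb R^{d\times n}$, and weights $Q\succeq 0$, $R\succ 0$, where $(A,B)$ is controllable and $(C,A)$, $(Q^{1/2},A)$ are observable (in the sense of the Kalman rank conditions). A controller $\mathsf K=(A_{\mathsf K},B_{\mathsf K},C_{\mathsf K})\in\mathbb R^{n\times n}\times\mathbb R^{n\times d}\times\mathbb R^{m\times n}$ acts by $\xi_{t+1}=A_{\mathsf K}\xi_t+B_{\mathsf K}y_t$, $u_t=C_{\mathsf K}\xi_t$; let $\mathbb K$ be the set of stabilizing controllers, i.e. those for which $\begin{bmatrix}A&BC_{\mathsf K}\\B_{\mathsf K}C&A_{\mathsf K}\end{bmatrix}$ has spectral radius less than $1$. The initial state $x_0$ is random and the initial estimate is designed as $\xi_0=B_{\mathsf K}s$ with a random vector $s\in\mathbb R^d$; $x_0$ and $s$ are square integrable, with $\mathbb E[x_0x_0^{\mathsf T}]=X_{11}$, $\mathbb E[ss^{\mathsf T}]=V$ and $\mathbb E[x_0s^{\mathsf T}]=0$. The problem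 is to minimize over $\mathsf K\in\mathbb K$ the cost $$J(\mathsf K)=\mathbb E\Big[\sum_{t=0}^\infty\big(x_t^{\mathsf T}Qx_t+u_t^{\mathsf T}Ru_t\big)\Big].$$ Call $\mathsf K$ stationary if the derivative of $J$ with respect to $(A_{\mathsf K},B_{\mathsf K},C_{\mathsf K})$ vanishes at $\mathsf K$, minimal if $(A_{\mathsf K},B_{\mathsf K})$ is reachable and $(C_{\mathsf K},A_{\mathsf K})$ is observable, and put $\mathscr T_T(\mathsf K)=(TA_{\mathsf K}T^{-1},TB_{\mathsf K},C_{\mathsf K}T^{-1})$ for $T\in\mathrm{GL}_n$. Suppose that $(A,X_{11}^{1/2})$ is reachable and $V\succ 0$. Then each of the Riccati equations $$\hat P=Q+A^{\mathsf T}\hat PA-A^{\mathsf T}\hat PB(R+B^{\mathsf T}\hat PB)^{-1}B^{\mathsf T}\hat PA,\qquad \hat\Sigma=X_{11}+A\hat\Sigma A^{\mathsf T}-A\hat\Sigma C^{\mathsf T}(C\hat\Sigma C^{\mathsf T}+V)^{-1}C\hat\Sigma A^{\mathsf T}$$ has a unique positive definite solution. Let $K^\star=(R+B^{\mathsf T}\hat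 PB)^{-1}B^{\mathsf T}\hat PA$, $L^\star=A\hat\Sigma C^{\mathsf T}(C\hat\Sigma C^{\mathsf T}+V)^{-1}$, and let $\mathsf K^\ddagger=(A-BK^\star-L^\star C,\;L^\star,\;-K^\star)$ be the corresponding observer-based controller. (i) Every minimal stationary point $\mathsf K\in\mathbb K$ is a global minimizer of $J$ over $\mathbb K$. (ii) Every minimal stationary point in $\mathbb K$ has the form $\mathscr T_T(\mathsf K^\ddagger)$ with $T\in\mathrm{GL}_n$. If $\mathsf K^\ddagger$ is minimal, the minimal stationary points in $\mathbb K$ are exactly the controllers $\mathscr T_T(\mathsf K^\ddagger)$ with $T\in\mathrm{GL}_n$ arbitrary; if $\mathsf K^\ddagger$ is not minimal, there are none. (iii) Whether or not $\mathsf K^\ddagger$ is minimal, every $\mathscr T_T(\mathsf K^\ddagger)$, $T\in\mathrm{GL}_n$, lies in $\mathbb K$, is stationary, and is a global minimizer of $J$ over $\mathbb K$. -/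

import Mathlib

namespace DLQR

open MeasureTheory Matrix

noncomputable section

/-- The positive semidefinite square root of a (positive semidefinite) real matrix. -/
def psdSqrt {n : ℕ} (M : Matrix (Fin n) (Fin n) ℝ) : Matrix (Fin n) (Fin n) ℝ :=
  open scoped MatrixOrder in CFC.sqrt M

/-- `(A, B)` is reachable (controllable): `[B, A B, …, A ^ (n - 1) B]` has rank `n`. -/
def Reachable {n m : ℕ} (A : Matrix (Fin n) (Fin n) ℝ) (B : Matrix (Fin n) (Fin m) ℝ) : Prop :=
  (Matrix.of fun (i : Fin n) (p : Fin n × Fin m) => (A ^ (p.1 : ℕ) * B) i p.2).rank = n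

/-- `(C, A)` is observable: `[C; C A; …; C A ^ (n - 1)]` has rank `n`. -/
def Observable {n d : ℕ} (C : Matrix (Fin d) (Fin n) ℝ) (A : Matrix (Fin n) (Fin n) ℝ) : Prop :=
  (Matrix.of fun (p : Fin n × Fin d) (j : Fin n) => (C * A ^ (p.1 : ℕ)) p.2 j).rank = n

/-- A strictly proper full-order dynamic controller `(A_K, B_K, C_K)`, regarded as a point of the
(finite-dimensional) product of the three matrix spaces. -/
abbrev Controller (n m d : ℕ) : Type :=
  Matrix (Fin n) (Fin n) ℝ × Matrix (Fin n) (Fin d) ℝ × Matrix (Fin m) (Fin n) ℝ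

namespace Controller

variable {n m d : ℕ}

/-- The matrix `A_K` of `ξ (t + 1) = A_K ξ t + B_K y t`. -/
abbrev AK (K : Controller n m d) : Matrix (Fin n) (Fin n) ℝ := K.1

/-- The matrix `B_K` of `ξ (t + 1) = A_K ξ t + B_K y t`. -/
abbrev BK (K : Controller n m d) : Matrix (Fin n) (Fin d) ℝ := K.2.1

/-- The matrix `C_K` of `u t = C_K ξ t`. -/
abbrev CK (K : Controller n m d) : Matrix (Fin m) (Fin n) ℝ := K.2.2

/-- A controller is minimal if it is reachable and observable. -/
def IsMinimal (K : Controller n m d) : Prop :=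
  Observable K.CK K.AK ∧ Reachable K.AK K.BK

/-- The similarity transformation `(T A_K T⁻¹, T B_K, C_K T⁻¹)` of a controller. -/
def similarity (T : GL (Fin n) ℝ) (K : Controller n m d) : Controller n m d :=
  ((T : Matrix (Fin n) (Fin n) ℝ) * K.AK * ((T⁻¹ : GL (Fin n) ℝ) : Matrix (Fin n) (Fin n) ℝ),
    (T : Matrix (Fin n) (Fin n) ℝ) * K.BK,
    K.CK * ((T⁻¹ : GL (Fin n) ℝ) : Matrix (Fin n) (Fin n) ℝ))

end Controller

/-- The closed-loop matrix `[A, B C_K; B_K C, A_K]`. -/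
def closedLoop {n m d : ℕ} (A : Matrix (Fin n) (Fin n) ℝ) (B : Matrix (Fin n) (Fin m) ℝ)
    (C : Matrix (Fin d) (Fin n) ℝ) (K : Controller n m d) :
    Matrix (Fin n ⊕ Fin n) (Fin n ⊕ Fin n) ℝ :=
  Matrix.fromBlocks A (B * K.CK) (K.BK * C) K.AK

/-- The set of stabilizing controllers: the closed-loop matrix has spectral radius (maximal modulus
of its complex eigenvalues) less than one. -/
def stabilizing {n m d : ℕ} (A : Matrix (Fin n) (Fin n) ℝ) (B : Matrix (Fin n) (Fin m) ℝ)
    (C : Matrix (Fin d) (Fin n) ℝ) : Set (Controller n m d) :=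
  {K | spectralRadius ℂ ((closedLoop A B C K).map (algebraMap ℝ ℂ)) < 1}

/-- The trajectory `t ↦ (x t, ξ t)` of the closed loop
`x (t + 1) = A x t + B u t`, `y t = C x t`, `ξ (t + 1) = A_K ξ t + B_K y t`, `u t = C_K ξ t`
from the initial state `x₀` and the initial estimate `ξ₀`. -/
def trajectory {n m d : ℕ} (A : Matrix (Fin n) (Fin n) ℝ) (B : Matrix (Fin n) (Fin m) ℝ)
    (C : Matrix (Fin d) (Fin n) ℝ) (K : Controller n m d) (x₀ ξ₀ : Fin n → ℝ) :
    ℕ → (Fin n → ℝ) × (Fin n → ℝ)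
  | 0 => (x₀, ξ₀)
  | t + 1 =>
    let z := trajectory A B C K x₀ ξ₀ t
    (A *ᵥ z.1 + B *ᵥ (K.CK *ᵥ z.2), K.AK *ᵥ z.2 + K.BK *ᵥ (C *ᵥ z.1))

/-- The accumulated quadratic cost `∑ t, (x tᵀ Q x t + u tᵀ R u t)`, with `u t = C_K ξ t`, along the
closed-loop trajectory from `(x₀, ξ₀)`. -/
def trajectoryCost {n m d : ℕ} (A : Matrix (Fin n) (Fin n) ℝ) (B : Matrix (Fin n) (Fin m) ℝ)
    (C : Matrix (Fin d) (Fin n) ℝ) (Q : Matrix (Fin n) (Fin n) ℝ) (R : Matrix (Fin m) (Fin m) ℝ)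
    (K : Controller n m d) (x₀ ξ₀ : Fin n → ℝ) : ℝ :=
  ∑' t : ℕ,
    ((trajectory A B C K x₀ ξ₀ t).1 ⬝ᵥ (Q *ᵥ (trajectory A B C K x₀ ξ₀ t).1) +
      (K.CK *ᵥ (trajectory A B C K x₀ ξ₀ t).2) ⬝ᵥ
        (R *ᵥ (K.CK *ᵥ (trajectory A B C K x₀ ξ₀ t).2)))

/-- The expected accumulated cost `J(K)` when the initial state is the random vector `x₀` and the
initial estimate is designed as `ξ₀ = B_K s` with the random vector `s`. -/
def cost {n m d : ℕ} (A : Matrix (Fin n) (Fin n) ℝ) (B : Matrix (Fin n) (Fin m) ℝ)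
    (C : Matrix (Fin d) (Fin n) ℝ) (Q : Matrix (Fin n) (Fin n) ℝ) (R : Matrix (Fin m) (Fin m) ℝ)
    {Ω : Type*} [MeasurableSpace Ω] (μ : Measure Ω) (x₀ : Ω → Fin n → ℝ) (s : Ω → Fin d → ℝ)
    (K : Controller n m d) : ℝ :=
  ∫ ω, trajectoryCost A B C Q R K (x₀ ω) (K.BK *ᵥ s ω) ∂μ

/-- The matrix `E[v wᵀ]` of two random vectors. -/
def secondMoment {k l : ℕ} {Ω : Type*} [MeasurableSpace Ω] (μ : Measure Ω)
    (v : Ω → Fin k → ℝ) (w : Ω → Fin l → ℝ) : Matrix (Fin k) (Fin l) ℝ :=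
  Matrix.of fun i j => ∫ ω, v ω i * w ω j ∂μ

/-- Stationary point of `J`: the total derivative with respect to `(A_K, B_K, C_K)` vanishes. -/
def IsStationary {n m d : ℕ} (J : Controller n m d → ℝ) (K : Controller n m d) : Prop :=
  HasFDerivAt J (0 : Controller n m d →L[ℝ] ℝ) K

/-- `P` is a positive definite solution of the control Riccati equation
`P = Q + Aᵀ P A - Aᵀ P B (R + Bᵀ P B)⁻¹ Bᵀ P A`. -/
def SolvesControlRiccati {n m : ℕ} (A : Matrix (Fin n) (Fin n) ℝ) (B : Matrix (Fin n) (Fin m) ℝ)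
    (Q : Matrix (Fin n) (Fin n) ℝ) (R : Matrix (Fin m) (Fin m) ℝ)
    (P : Matrix (Fin n) (Fin n) ℝ) : Prop :=
  P.PosDef ∧ P = Q + Aᵀ * P * A - Aᵀ * P * B * (R + Bᵀ * P * B)⁻¹ * Bᵀ * P * A

/-- `S` is a positive definite solution of the filtering Riccati equation
`S = W + A S Aᵀ - A S Cᵀ (C S Cᵀ + V)⁻¹ C S Aᵀ`. -/
def SolvesFilterRiccati {n d : ℕ} (A : Matrix (Fin n) (Fin n) ℝ) (C : Matrix (Fin d) (Fin n) ℝ)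
    (W : Matrix (Fin n) (Fin n) ℝ) (V : Matrix (Fin d) (Fin d) ℝ)
    (S : Matrix (Fin n) (Fin n) ℝ) : Prop :=
  S.PosDef ∧ S = W + A * S * Aᵀ - A * S * Cᵀ * (C * S * Cᵀ + V)⁻¹ * C * S * Aᵀ

/-- The LQR gain `(R + Bᵀ P B)⁻¹ Bᵀ P A`. -/
def lqrGain {n m : ℕ} (A : Matrix (Fin n) (Fin n) ℝ) (B : Matrix (Fin n) (Fin m) ℝ)
    (R : Matrix (Fin m) (Fin m) ℝ) (P : Matrix (Fin n) (Fin n) ℝ) : Matrix (Fin m) (Fin n) ℝ :=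
  (R + Bᵀ * P * B)⁻¹ * Bᵀ * P * A

/-- The Kalman gain `A S Cᵀ (C S Cᵀ + V)⁻¹`. -/
def kalmanGain {n d : ℕ} (A : Matrix (Fin n) (Fin n) ℝ) (C : Matrix (Fin d) (Fin n) ℝ)
    (V : Matrix (Fin d) (Fin d) ℝ) (S : Matrix (Fin n) (Fin n) ℝ) : Matrix (Fin n) (Fin d) ℝ :=
  A * S * Cᵀ * (C * S * Cᵀ + V)⁻¹

/-- The observer-based controller `A_K = A - B K - L C`, `B_K = L`, `C_K = -K` with feedback gain
`K` and observer gain `L`. -/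
def observerController {n m d : ℕ} (A : Matrix (Fin n) (Fin n) ℝ) (B : Matrix (Fin n) (Fin m) ℝ)
    (C : Matrix (Fin d) (Fin n) ℝ) (K : Matrix (Fin m) (Fin n) ℝ) (L : Matrix (Fin n) (Fin d) ℝ) :
    Controller n m d :=
  (A - B * K - L * C, L, -K)

end

end DLQR

/-! Summing second moments along the closed loop gives `J(K) = tr (diag(Q, C_Kᵀ R C_K) S)`, where
`S` solves the Lyapunov equation driven by `diag(X₁₁, B_K V B_Kᵀ)` (`cost_eq_trace`,
`lyapunov_trace_duality`). Thanks to the design `ξ₀ = B_K s` this is the cost of an LQG problem with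
process noise `X₁₁` and measurement noise `V`. Transposing all data exchanges control and filtering,
so each half needs only one proof (`dualController`).

Riccati equations. Value iteration from `0` increases and is bounded by the cost of a deadbeat
input, so it converges to a solution. Observability makes every semidefinite solution definite and
stabilizing, and the difference of two solutions solves a homogeneous Sylvester equation with stable
coefficients, hence is zero (`riccati_unique`).

Global optimality. By completion of squares, `diag(P̂, 0)` and `diag(Σ̂, 0)` solve the closed-loop
Lyapunov equations up to a square. Subtracting them gives `J = const + tr ((R + Bᵀ P̂ B) G D Gᵀ)`
with `G = [K⋆ C_K]` and `D ⪰ 0` (`IsGramianCost.eq_add`). For the observer-based controller `D`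
lives on the diagonal `{(x, x)}`, where `G` vanishes, so this controller is a minimizer. Similarity
preserves `J`, the stabilizing set is open and `J` is differentiable on it; hence all transforms are
minimizers and stationary.

Rigidity. For a minimal controller the lower right blocks of both Gramians `S`, `P` are definite, so
`N = -P₂₂⁻¹ P₂₁` and `M = S₁₂ S₂₂⁻¹` make sense. The stationarity conditions in `A_K`, `B_K` and the
Lyapunov equation force `N M = 1`, and the Schur complement `S₁₁ - S₁₂ S₂₂⁻¹ S₂₁` solves the filter
Riccati equation, so it is `Σ̂` (`kalman_of_stationary`). This fixes `B_K`, and `A_K` in terms of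
`C_K`; the dual argument fixes `C_K`. The result is the transform by `T = N`. -/

namespace DLQR

open Matrix Filter Topology

/-! ### Real positive semidefinite matrices and their quadratic forms. -/

section Basics

variable {ι κ : Type*} [Fintype ι] [Fintype κ]

theorem PosSemidef.transpose_eq {ι : Type*} {P : Matrix ι ι ℝ} (hP : P.PosSemidef) : Pᵀ = P := by
  simpa [conjTranspose_eq_transpose_of_trivial] using hP.isHermitian.eq

theorem PosDef.transpose_eq {ι : Type*} {P : Matrix ι ι ℝ} (hP : P.PosDef) : Pᵀ = P :=
  PosSemidef.transpose_eq hP.posSemidef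

theorem PosSemidef.conj {P : Matrix ι ι ℝ} (hP : P.PosSemidef) (F : Matrix ι κ ℝ) :
    (Fᵀ * P * F).PosSemidef := by
  simpa [conjTranspose_eq_transpose_of_trivial] using hP.conjTranspose_mul_mul_same F

theorem PosSemidef.conj' {P : Matrix ι ι ℝ} (hP : P.PosSemidef) (F : Matrix κ ι ℝ) :
    (F * P * Fᵀ).PosSemidef := by
  simpa [conjTranspose_eq_transpose_of_trivial] using hP.mul_mul_conjTranspose_same F

theorem posSemidef_iff_real {P : Matrix ι ι ℝ} :
    P.PosSemidef ↔ Pᵀ = P ∧ ∀ x, 0 ≤ x ⬝ᵥ (P *ᵥ x) := by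
  rw [posSemidef_iff_dotProduct_mulVec, IsHermitian, conjTranspose_eq_transpose_of_trivial]
  simp

theorem dotProduct_conj_mulVec (P : Matrix ι ι ℝ) (F : Matrix ι κ ℝ) (x : κ → ℝ) :
    x ⬝ᵥ ((Fᵀ * P * F) *ᵥ x) = (F *ᵥ x) ⬝ᵥ (P *ᵥ (F *ᵥ x)) := by
  rw [← mulVec_mulVec, ← mulVec_mulVec, dotProduct_mulVec, vecMul_transpose]

theorem PosSemidef.mulVec_eq_zero {P : Matrix ι ι ℝ} (hP : P.PosSemidef) {x : ι → ℝ}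
    (h : x ⬝ᵥ (P *ᵥ x) = 0) : P *ᵥ x = 0 :=
  (hP.dotProduct_mulVec_zero_iff x).1 (by simpa using h)

theorem PosSemidef.posDef_of_ker {P : Matrix ι ι ℝ} (hP : P.PosSemidef)
    (h : ∀ x, P *ᵥ x = 0 → x = 0) : P.PosDef := by
  refine .of_dotProduct_mulVec_pos hP.isHermitian fun x hx => ?_
  refine lt_of_le_of_ne (hP.dotProduct_mulVec_nonneg x) fun h0 => hx (h x ?_)
  exact PosSemidef.mulVec_eq_zero hP (by simpa using h0.symm)

theorem PosDef.mulVec_eq_zero {P : Matrix ι ι ℝ} (hP : P.PosDef) {x : ι → ℝ}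
    (h : x ⬝ᵥ (P *ᵥ x) = 0) : x = 0 := by
  by_contra hx
  have := hP.dotProduct_mulVec_pos hx
  simp [h] at this

theorem posDef_add_conj {R : Matrix ι ι ℝ} (hR : R.PosDef) {P : Matrix κ κ ℝ} (hP : P.PosSemidef)
    (B : Matrix κ ι ℝ) : (R + Bᵀ * P * B).PosDef :=
  hR.add_posSemidef (PosSemidef.conj hP B)

end Basics

/-! ### Kalman rank conditions. -/

section Kalman

variable {n m d : ℕ}

theorem psdSqrt_mul_self {M : Matrix (Fin n) (Fin n) ℝ} (hM : M.PosSemidef) :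
    psdSqrt M * psdSqrt M = M := by
  open scoped MatrixOrder in exact CFC.sqrt_mul_sqrt_self M hM.nonneg

theorem psdSqrt_transpose (M : Matrix (Fin n) (Fin n) ℝ) : (psdSqrt M)ᵀ = psdSqrt M := by
  have : (psdSqrt M).PosSemidef := by
    open scoped MatrixOrder in exact Matrix.nonneg_iff_posSemidef.1 (CFC.sqrt_nonneg M)
  exact PosSemidef.transpose_eq this

theorem psdSqrt_mulVec_eq_zero {M : Matrix (Fin n) (Fin n) ℝ} (hM : M.PosSemidef)
    {x : Fin n → ℝ} (h : x ⬝ᵥ (M *ᵥ x) = 0) : psdSqrt M *ᵥ x = 0 := by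
  rw [← psdSqrt_mul_self hM, ← mulVec_mulVec, dotProduct_mulVec, ← mulVec_transpose,
    psdSqrt_transpose] at h
  exact dotProduct_self_eq_zero.1 h

/-- Rank-nullity. The trivial-kernel form is the one that meets kernels of Gramians and Riccati
solutions below. -/
theorem observable_iff {C : Matrix (Fin d) (Fin n) ℝ} {A : Matrix (Fin n) (Fin n) ℝ} :
    Observable C A ↔ ∀ x, (∀ t < n, C *ᵥ ((A ^ t) *ᵥ x) = 0) → x = 0 := by
  set O : Matrix (Fin n × Fin d) (Fin n) ℝ :=
    Matrix.of fun (p : Fin n × Fin d) (j : Fin n) => (C * A ^ (p.1 : ℕ)) p.2 j with hO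
  have h1 : Observable C A ↔ LinearMap.ker O.mulVecLin = ⊥ := by
    have := O.mulVecLin.finrank_range_add_finrank_ker
    rw [Module.finrank_fin_fun] at this
    change Module.finrank ℝ (LinearMap.range O.mulVecLin) = n ↔ _
    rw [← Submodule.finrank_eq_zero (R := ℝ)]
    omega
  rw [h1, LinearMap.ker_eq_bot']
  have h2 : ∀ x, O.mulVecLin x = 0 ↔ ∀ t < n, C *ᵥ ((A ^ t) *ᵥ x) = 0 := by
    intro x
    constructor
    · intro h t ht
      ext i
      have := congrFun h (⟨t, ht⟩, i)
      rw [mulVec_mulVec]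
      exact this
    · intro h
      ext ⟨t, i⟩
      have := congrFun (h t t.2) i
      rw [mulVec_mulVec] at this
      exact this
  simp_rw [h2]

theorem reachable_iff_observable {A : Matrix (Fin n) (Fin n) ℝ} {B : Matrix (Fin n) (Fin m) ℝ} :
    Reachable A B ↔ Observable Bᵀ Aᵀ := by
  unfold Reachable Observable
  rw [← rank_transpose]
  have : ∀ t : ℕ, Bᵀ * Aᵀ ^ t = (A ^ t * B)ᵀ := fun t => by
    rw [transpose_mul, transpose_pow]
  simp_rw [this]
  rfl

theorem observable_iff_reachable {C : Matrix (Fin d) (Fin n) ℝ} {A : Matrix (Fin n) (Fin n) ℝ} :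
    Observable C A ↔ Reachable Aᵀ Cᵀ := by
  rw [reachable_iff_observable, transpose_transpose, transpose_transpose]

/-- Full row rank gives the reachability matrix a right inverse `Y`; the `U t` are the blocks of `Y
* X`. -/
theorem Reachable.exists_eq_sum {A : Matrix (Fin n) (Fin n) ℝ} {B : Matrix (Fin n) (Fin m) ℝ}
    (h : Reachable A B) (X : Matrix (Fin n) (Fin n) ℝ) :
    ∃ U : ℕ → Matrix (Fin m) (Fin n) ℝ, X = ∑ t ∈ Finset.range n, A ^ t * B * U t := by
  set O : Matrix (Fin n) (Fin n × Fin m) ℝ :=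
    Matrix.of fun (i : Fin n) (p : Fin n × Fin m) => (A ^ (p.1 : ℕ) * B) i p.2 with hO
  have hsurj : Function.Surjective O.mulVec := by
    have : LinearMap.range O.mulVecLin = ⊤ := by
      apply Submodule.eq_top_of_finrank_eq
      rw [Module.finrank_fin_fun]
      exact h
    exact LinearMap.range_eq_top.1 this
  obtain ⟨Y, hY⟩ := mulVec_surjective_iff_exists_right_inverse.1 hsurj
  refine ⟨fun t => if ht : t < n then Matrix.of fun a j => (Y * X) (⟨t, ht⟩, a) j else 0, ?_⟩
  have h1 : X = O * (Y * X) := by rw [← Matrix.mul_assoc, hY, Matrix.one_mul]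
  rw [Finset.sum_range]
  conv_lhs => rw [h1]
  ext i j
  rw [mul_apply, Fintype.sum_prod_type, Matrix.sum_apply]
  simp [mul_apply, hO]

end Kalman

end DLQR

namespace DLQR

open Matrix Filter Topology

/-! ### Schur stability and Lyapunov equations. -/

section Stability

variable {ι κ : Type*} [Fintype ι] [Fintype κ] [DecidableEq ι] [DecidableEq κ]

section Spectral
attribute [local instance] Matrix.linftyOpNormedRing Matrix.linftyOpNormedAlgebra

theorem spectralRadius_lt_one_iff (M : Matrix ι ι ℂ) :
    spectralRadius ℂ M < 1 ↔ ∀ z ∈ spectrum ℂ M, ‖z‖ < 1 := by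
  constructor
  · intro h z hz
    have : (‖z‖₊ : ENNReal) < 1 := lt_of_le_of_lt (le_iSup₂ (α := ENNReal) z hz) h
    exact_mod_cast this
  · intro h
    rcases isEmpty_or_nonempty ι with hι | hι
    · simp [spectralRadius]
    · have := spectrum.spectralRadius_lt_of_forall_lt (A := Matrix ι ι ℂ) M (r := 1)
        fun z hz => by exact_mod_cast h z hz
      exact_mod_cast this

/-- Gelfand's formula gives geometric decay; conversely `‖z‖ ^ t` is bounded by `‖M ^ t‖ * ‖1‖` for
`z` in the spectrum. -/
theorem spectralRadius_lt_one_iff_tendsto (M : Matrix ι ι ℂ) :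
    spectralRadius ℂ M < 1 ↔ Tendsto (fun t : ℕ => M ^ t) atTop (𝓝 0) := by
  constructor
  · intro h
    obtain ⟨r, hr0, hr1⟩ := ENNReal.lt_iff_exists_nnreal_btwn.1 h
    have hr : (r : ENNReal) < 1 := hr1
    have hev := (spectrum.pow_nnnorm_pow_one_div_tendsto_nhds_spectralRadius M).eventually
      (gt_mem_nhds hr0)
    refine (tendsto_zero_iff_norm_tendsto_zero (E := Matrix ι ι ℂ)).2 ?_
    have hr' : r < 1 := by exact_mod_cast hr
    refine squeeze_zero' (g := fun t : ℕ => (r : ℝ) ^ t)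
      (Eventually.of_forall fun _ => norm_nonneg _) ?_
      (tendsto_pow_atTop_nhds_zero_of_lt_one r.2 (by exact_mod_cast hr'))
    filter_upwards [hev, eventually_gt_atTop 0] with t ht ht0
    have h2 : ((‖M ^ t‖₊ : ENNReal) ^ (1 / t : ℝ)) ^ (t : ℝ) ≤ (r : ENNReal) ^ (t : ℝ) :=
      ENNReal.rpow_le_rpow ht.le (by positivity)
    rw [← ENNReal.rpow_mul, one_div_mul_cancel (by positivity), ENNReal.rpow_one,
      ENNReal.rpow_natCast] at h2
    exact_mod_cast h2
  · intro h
    rw [spectralRadius_lt_one_iff]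
    intro z hz
    have h1 : Tendsto (fun t : ℕ => ‖M ^ t‖ * ‖(1 : Matrix ι ι ℂ)‖) atTop (𝓝 0) := by
      have := (tendsto_zero_iff_norm_tendsto_zero.1 h).mul_const ‖(1 : Matrix ι ι ℂ)‖
      simpa using this
    have h2 : Tendsto (fun t : ℕ => ‖z‖ ^ t) atTop (𝓝 0) := by
      refine squeeze_zero (fun _ => by positivity) (fun t => ?_) h1
      rw [← norm_pow]
      exact spectrum.norm_le_norm_mul_of_mem (spectrum.pow_mem_pow M t hz)
    by_contra hz1
    push Not at hz1
    have h3 := ge_of_tendsto' h2 fun t => one_le_pow₀ hz1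
    linarith

end Spectral

/-- A real square matrix is Schur stable if its powers tend to zero. -/
def SchurStable (M : Matrix ι ι ℝ) : Prop := Tendsto (fun t : ℕ => M ^ t) atTop (𝓝 0)

theorem schurStable_iff_spectralRadius (M : Matrix ι ι ℝ) :
    spectralRadius ℂ (M.map (algebraMap ℝ ℂ)) < 1 ↔ SchurStable M := by
  rw [spectralRadius_lt_one_iff_tendsto, SchurStable]
  have h1 : ∀ t : ℕ, (M.map (algebraMap ℝ ℂ)) ^ t = (M ^ t).map (algebraMap ℝ ℂ) := fun t => by
    have := map_pow (algebraMap ℝ ℂ).mapMatrix M t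
    simpa using this.symm
  have hind : IsInducing fun X : Matrix ι ι ℝ => X.map (algebraMap ℝ ℂ) :=
    IsInducing.matrix_map (Complex.isometry_ofReal.isEmbedding.isInducing)
  rw [hind.tendsto_nhds_iff]
  simp only [h1]
  have h0 : (0 : Matrix ι ι ℝ).map (algebraMap ℝ ℂ) = 0 := by ext; simp
  rw [h0]
  rfl

/-- On the spectral side this is immediate: a block triangular `z - M` is invertible iff its
diagonal blocks are. -/
theorem schurStable_fromBlocks_zero₂₁ {M : Matrix ι ι ℝ} {N : Matrix κ κ ℝ} (hM : SchurStable M)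
    (hN : SchurStable N) (G : Matrix ι κ ℝ) : SchurStable (fromBlocks M G 0 N) := by
  rw [← schurStable_iff_spectralRadius, spectralRadius_lt_one_iff] at *
  intro z hz
  rw [spectrum.mem_iff] at hz
  have h1 : algebraMap ℂ (Matrix (ι ⊕ κ) (ι ⊕ κ) ℂ) z -
      (fromBlocks M G 0 N).map (algebraMap ℝ ℂ) =
      fromBlocks (algebraMap ℂ _ z - M.map (algebraMap ℝ ℂ)) (-(G.map (algebraMap ℝ ℂ))) 0
        (algebraMap ℂ _ z - N.map (algebraMap ℝ ℂ)) := by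
    ext i j
    rcases i with i | i <;> rcases j with j | j <;> simp [algebraMap_matrix_apply]
  rw [h1, isUnit_fromBlocks_zero₂₁, not_and_or] at hz
  rcases hz with hz | hz
  · exact hM z (spectrum.mem_iff.2 hz)
  · exact hN z (spectrum.mem_iff.2 hz)

theorem SchurStable.transpose {M : Matrix ι ι ℝ} (hM : SchurStable M) : SchurStable Mᵀ := by
  unfold SchurStable at *
  have : Tendsto (fun t : ℕ => (M ^ t)ᵀ) atTop (𝓝 0ᵀ) :=
    (continuous_id.matrix_transpose.tendsto (0 : Matrix ι ι ℝ)).comp hM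
  simpa [transpose_pow] using this

theorem SchurStable.conj {M : Matrix ι ι ℝ} (hM : SchurStable M) {T T' : Matrix ι ι ℝ}
    (hT : T' * T = 1) : SchurStable (T * M * T') := by
  have h1 : ∀ t : ℕ, (T * M * T') ^ t = T * M ^ t * T' := by
    intro t
    induction t with
    | zero => simp [mul_eq_one_comm.1 hT]
    | succ t ih =>
      rw [pow_succ, ih, pow_succ]
      simp only [Matrix.mul_assoc]
      rw [← Matrix.mul_assoc T' T, hT, Matrix.one_mul]
  have h2 : Continuous fun X : Matrix ι ι ℝ => T * X * T' := by fun_prop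
  have := (h2.tendsto 0).comp hM
  unfold SchurStable
  simpa [h1, Function.comp_def] using this

theorem schurStable_of_mulVec {M : Matrix ι ι ℝ}
    (h : ∀ x, Tendsto (fun t : ℕ => (M ^ t) *ᵥ x) atTop (𝓝 0)) : SchurStable M := by
  unfold SchurStable
  refine tendsto_pi_nhds.2 fun i => tendsto_pi_nhds.2 fun j => ?_
  have := tendsto_pi_nhds.1 (h (Pi.single j 1)) i
  simpa using this

theorem SchurStable.mulVec {M : Matrix ι ι ℝ} (h : SchurStable M) (x : ι → ℝ) :
    Tendsto (fun t : ℕ => (M ^ t) *ᵥ x) atTop (𝓝 0) := by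
  have h2 : Continuous fun X : Matrix ι ι ℝ => X *ᵥ x := by fun_prop
  simpa [Function.comp_def] using (h2.tendsto 0).comp h

/-- Solutions of the homogeneous Sylvester equation with stable coefficients vanish. -/
theorem SchurStable.eq_zero_of_eq_mul_mul {M : Matrix ι ι ℝ} {N : Matrix κ κ ℝ}
    (hM : SchurStable M) (hN : SchurStable N) {X : Matrix ι κ ℝ} (h : X = M * X * N) : X = 0 := by
  -- Iterating the equation exhibits the constant `X` as a sequence that tends to zero.
  have h1 : ∀ t : ℕ, X = M ^ t * X * N ^ t := by
    intro t
    induction t with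
    | zero => simp
    | succ t ih =>
      conv_lhs => rw [ih, h]
      rw [pow_succ, pow_succ']
      simp only [Matrix.mul_assoc]
  have h2 : Continuous fun p : Matrix ι ι ℝ × Matrix κ κ ℝ => p.1 * X * p.2 := by fun_prop
  have h3 := (h2.tendsto (0, 0)).comp (hM.prodMk_nhds hN)
  have h4 : Tendsto (fun _ : ℕ => X) atTop (𝓝 0) := by
    refine Tendsto.congr (fun t => (h1 t).symm) ?_
    simpa [Function.comp_def] using h3
  exact tendsto_nhds_unique tendsto_const_nhds h4

theorem SchurStable.lyapunov_unique {M : Matrix ι ι ℝ} (hM : SchurStable M)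
    {X Y W : Matrix ι ι ℝ} (hX : X = W + M * X * Mᵀ) (hY : Y = W + M * Y * Mᵀ) : X = Y := by
  refine sub_eq_zero.1 (hM.eq_zero_of_eq_mul_mul hM.transpose ?_)
  conv_lhs => rw [hX, hY]
  noncomm_ring

/-- `X ↦ X - M X Mᵀ` is injective by stability, hence surjective in finite dimension. -/
theorem SchurStable.exists_lyapunov {M : Matrix ι ι ℝ} (hM : SchurStable M) (W : Matrix ι ι ℝ) :
    ∃ X : Matrix ι ι ℝ, X = W + M * X * Mᵀ := by
  let L : Matrix ι ι ℝ →ₗ[ℝ] Matrix ι ι ℝ :=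
    LinearMap.id - LinearMap.mulLeft ℝ M ∘ₗ LinearMap.mulRight ℝ Mᵀ
  have hL : ∀ X, L X = X - M * (X * Mᵀ) := fun X => rfl
  have hinj : Function.Injective L := by
    rw [← LinearMap.ker_eq_bot, LinearMap.ker_eq_bot']
    intro X hX
    rw [hL, sub_eq_zero] at hX
    exact hM.eq_zero_of_eq_mul_mul hM.transpose (by rwa [Matrix.mul_assoc])
  obtain ⟨X, hX⟩ := (LinearMap.injective_iff_surjective.1 hinj) W
  refine ⟨X, ?_⟩
  rw [hL] at hX
  rw [← hX, Matrix.mul_assoc, sub_add_cancel]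

theorem SchurStable.lyapunov_symm {M : Matrix ι ι ℝ} (hM : SchurStable M) {X W : Matrix ι ι ℝ}
    (hX : X = W + M * X * Mᵀ) (hW : Wᵀ = W) : Xᵀ = X := by
  refine hM.lyapunov_unique (W := W) ?_ hX
  conv_lhs => rw [hX]
  simp [hW, Matrix.mul_assoc]

/-- Along an orbit of `Mᵀ` the form of `X` never increases, since each step loses the nonnegative
form of `W`; its limit is zero by stability. -/
theorem SchurStable.lyapunov_posSemidef {M : Matrix ι ι ℝ} (hM : SchurStable M)
    {X W : Matrix ι ι ℝ} (hX : X = W + M * X * Mᵀ) (hW : W.PosSemidef) : X.PosSemidef := by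
  refine posSemidef_iff_real.2 ⟨hM.lyapunov_symm hX (PosSemidef.transpose_eq hW), fun x => ?_⟩
  have h1 : ∀ x : ι → ℝ, (Mᵀ *ᵥ x) ⬝ᵥ (X *ᵥ (Mᵀ *ᵥ x)) ≤ x ⬝ᵥ (X *ᵥ x) := by
    intro x
    conv_rhs => rw [hX]
    rw [add_mulVec, dotProduct_add, ← dotProduct_conj_mulVec, transpose_transpose]
    linarith [(posSemidef_iff_real.1 hW).2 x]
  have h2 : ∀ t : ℕ, ((Mᵀ ^ t) *ᵥ x) ⬝ᵥ (X *ᵥ ((Mᵀ ^ t) *ᵥ x)) ≤ x ⬝ᵥ (X *ᵥ x) := by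
    intro t
    induction t with
    | zero => simp
    | succ t ih =>
      rw [pow_succ', ← mulVec_mulVec]
      exact (h1 _).trans ih
  have h3 : Continuous fun y : ι → ℝ => y ⬝ᵥ (X *ᵥ y) := by fun_prop
  have h4 := (h3.tendsto 0).comp (hM.transpose.mulVec x)
  simp only [zero_dotProduct] at h4
  exact le_of_tendsto' h4 h2

end Stability

end DLQR

namespace DLQR

open Matrix Filter Topology

/-! ### Existence, uniqueness and stabilizing property of Riccati solutions. -/

section Riccati

variable {n m : ℕ} {A : Matrix (Fin n) (Fin n) ℝ} {B : Matrix (Fin n) (Fin m) ℝ}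
  {Q : Matrix (Fin n) (Fin n) ℝ} {R : Matrix (Fin m) (Fin m) ℝ}

/-- The right-hand side of the control Riccati equation. -/
noncomputable def riccatiMap (A : Matrix (Fin n) (Fin n) ℝ) (B : Matrix (Fin n) (Fin m) ℝ)
    (Q : Matrix (Fin n) (Fin n) ℝ) (R : Matrix (Fin m) (Fin m) ℝ)
    (P : Matrix (Fin n) (Fin n) ℝ) : Matrix (Fin n) (Fin n) ℝ :=
  Q + Aᵀ * P * A - Aᵀ * P * B * (R + Bᵀ * P * B)⁻¹ * Bᵀ * P * A

theorem mul_lqrGain (hR : R.PosDef) {P : Matrix (Fin n) (Fin n) ℝ} (hP : P.PosSemidef) :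
    (R + Bᵀ * P * B) * lqrGain A B R P = Bᵀ * P * A := by
  have hu : IsUnit (R + Bᵀ * P * B).det :=
    (isUnit_iff_isUnit_det _).1 (posDef_add_conj hR hP B).isUnit
  simpa only [lqrGain, Matrix.mul_assoc] using mul_nonsing_inv_cancel_left _ (Bᵀ * P * A) hu

theorem lqrGain_transpose (hR : R.PosDef) {P : Matrix (Fin n) (Fin n) ℝ} (hP : P.PosSemidef) :
    (lqrGain A B R P)ᵀ = Aᵀ * P * B * (R + Bᵀ * P * B)⁻¹ := by
  rw [lqrGain, transpose_mul, transpose_mul, transpose_mul, transpose_transpose,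
    transpose_nonsing_inv, PosDef.transpose_eq (posDef_add_conj hR hP B),
    PosSemidef.transpose_eq hP, ← Matrix.mul_assoc, ← Matrix.mul_assoc]

theorem riccatiMap_eq (hR : R.PosDef) {P : Matrix (Fin n) (Fin n) ℝ} (hP : P.PosSemidef) :
    riccatiMap A B Q R P = Q + Aᵀ * P * A -
      (lqrGain A B R P)ᵀ * (R + Bᵀ * P * B) * lqrGain A B R P := by
  rw [Matrix.mul_assoc _ (R + Bᵀ * P * B), mul_lqrGain hR hP, lqrGain_transpose hR hP, riccatiMap]
  simp only [Matrix.mul_assoc]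

/-- Completion of squares in the Bellman operator of the linear quadratic regulator. -/
theorem riccati_completion {κ : Type*} (hR : R.PosDef) {P : Matrix (Fin n) (Fin n) ℝ}
    (hP : P.PosSemidef) (X : Matrix (Fin n) κ ℝ) (U : Matrix (Fin m) κ ℝ) :
    Xᵀ * Q * X + Uᵀ * R * U + (A * X + B * U)ᵀ * P * (A * X + B * U) =
      Xᵀ * riccatiMap A B Q R P * X + (U + lqrGain A B R P * X)ᵀ * (R + Bᵀ * P * B) *
        (U + lqrGain A B R P * X) := by
  rw [riccatiMap_eq hR hP]
  have h1 := mul_lqrGain (A := A) (B := B) hR hP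
  have h2 : (lqrGain A B R P)ᵀ * (R + Bᵀ * P * B) = Aᵀ * P * B := by
    have := congrArg transpose h1
    rwa [transpose_mul, PosDef.transpose_eq (posDef_add_conj hR hP B), transpose_mul, transpose_mul,
      transpose_transpose, PosSemidef.transpose_eq hP, ← Matrix.mul_assoc] at this
  have h3 : (U + lqrGain A B R P * X)ᵀ * (R + Bᵀ * P * B) * (U + lqrGain A B R P * X) =
      Uᵀ * (R + Bᵀ * P * B) * U + Uᵀ * ((R + Bᵀ * P * B) * lqrGain A B R P) * X +
        Xᵀ * ((lqrGain A B R P)ᵀ * (R + Bᵀ * P * B)) * U +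
        Xᵀ * ((lqrGain A B R P)ᵀ * (R + Bᵀ * P * B) * lqrGain A B R P) * X := by
    simp only [transpose_add, transpose_mul, Matrix.add_mul, Matrix.mul_add, Matrix.mul_assoc]
    abel
  rw [h3, h1, h2]
  simp only [transpose_add, transpose_mul, Matrix.add_mul, Matrix.mul_add, Matrix.mul_assoc,
    Matrix.sub_mul, Matrix.mul_sub]
  abel

/-- The case `u = -F x`: `riccatiMap` is the cost of the best one-step gain, and any other gain pays
the square on the right. -/
theorem riccati_completion_gain (hR : R.PosDef) {P : Matrix (Fin n) (Fin n) ℝ}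
    (hP : P.PosSemidef) (F : Matrix (Fin m) (Fin n) ℝ) :
    Q + Fᵀ * R * F + (A - B * F)ᵀ * P * (A - B * F) =
      riccatiMap A B Q R P + (lqrGain A B R P - F)ᵀ * (R + Bᵀ * P * B) *
        (lqrGain A B R P - F) := by
  have := riccati_completion (A := A) (B := B) (Q := Q) hR hP 1 (-F)
  simpa [sub_eq_add_neg, add_comm (-F)] using this

theorem riccatiMap_eq_lyapunov (hR : R.PosDef) {P : Matrix (Fin n) (Fin n) ℝ}
    (hP : P.PosSemidef) :
    riccatiMap A B Q R P = Q + (lqrGain A B R P)ᵀ * R * lqrGain A B R P +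
      (A - B * lqrGain A B R P)ᵀ * P * (A - B * lqrGain A B R P) := by
  rw [riccati_completion_gain hR hP]
  simp

theorem riccatiMap_posSemidef (hQ : Q.PosSemidef) (hR : R.PosDef) {P : Matrix (Fin n) (Fin n) ℝ}
    (hP : P.PosSemidef) : (riccatiMap A B Q R P).PosSemidef := by
  rw [riccatiMap_eq_lyapunov hR hP]
  exact (hQ.add (PosSemidef.conj hR.posSemidef _)).add (PosSemidef.conj hP _)

/-- The optimal gain for `P'` is also available, though suboptimal, for `P`. With this common gain
the costs differ by a congruence of `P' - P`, and suboptimality adds a square. -/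
theorem riccatiMap_mono (hR : R.PosDef) {P P' : Matrix (Fin n) (Fin n) ℝ}
    (hP : P.PosSemidef) (hP' : P'.PosSemidef) (h : (P' - P).PosSemidef) :
    (riccatiMap A B Q R P' - riccatiMap A B Q R P).PosSemidef := by
  have h1 := riccati_completion_gain (A := A) (B := B) (Q := Q) hR hP (lqrGain A B R P')
  have h2 : riccatiMap A B Q R P' - riccatiMap A B Q R P =
      (A - B * lqrGain A B R P')ᵀ * (P' - P) * (A - B * lqrGain A B R P') +
      (lqrGain A B R P - lqrGain A B R P')ᵀ * (R + Bᵀ * P * B) *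
        (lqrGain A B R P - lqrGain A B R P') := by
    rw [eq_sub_of_add_eq' h1.symm, riccatiMap_eq_lyapunov hR hP']
    generalize A - B * lqrGain A B R P' = F
    rw [Matrix.mul_sub, Matrix.sub_mul]
    abel
  rw [h2]
  exact (PosSemidef.conj h _).add (PosSemidef.conj (posDef_add_conj hR hP B).posSemidef _)

/-- A positive semidefinite solution of the Riccati equation is positive definite. -/
theorem riccati_posDef (hQ : Q.PosSemidef) (hR : R.PosDef) (hQA : Observable (psdSqrt Q) A)
    {P : Matrix (Fin n) (Fin n) ℝ} (hP : P.PosSemidef) (h : P = riccatiMap A B Q R P) :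
    P.PosDef := by
  refine PosSemidef.posDef_of_ker hP fun x hx => observable_iff.1 hQA x fun t _ => ?_
  -- The kernel of `P` is `A`-invariant and lies in the kernel of `psdSqrt Q`: all three terms of
  -- the Lyapunov form vanish on it, and `K x = 0` turns `A - B K` into `A`.
  have hstep : ∀ x, P *ᵥ x = 0 → psdSqrt Q *ᵥ x = 0 ∧ P *ᵥ (A *ᵥ x) = 0 := by
    intro x hx
    set K := lqrGain A B R P
    have h0 : x ⬝ᵥ (P *ᵥ x) = 0 := by rw [hx, dotProduct_zero]
    rw [h, riccatiMap_eq_lyapunov hR hP, add_mulVec, add_mulVec, dotProduct_add, dotProduct_add,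
      dotProduct_conj_mulVec, dotProduct_conj_mulVec] at h0
    have h1 := (posSemidef_iff_real.1 hQ).2 x
    have h2 := (posSemidef_iff_real.1 hR.posSemidef).2 (K *ᵥ x)
    have h3 := (posSemidef_iff_real.1 hP).2 ((A - B * K) *ᵥ x)
    have h4 : K *ᵥ x = 0 := PosDef.mulVec_eq_zero hR (by linarith)
    have h5 := PosSemidef.mulVec_eq_zero hP (x := (A - B * K) *ᵥ x) (by linarith)
    rw [sub_mulVec, ← mulVec_mulVec, h4, mulVec_zero, sub_zero] at h5
    exact ⟨psdSqrt_mulVec_eq_zero hQ (by linarith), h5⟩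
  have : ∀ t : ℕ, P *ᵥ ((A ^ t) *ᵥ x) = 0 := by
    intro t
    induction t with
    | zero => simpa using hx
    | succ t ih =>
      rw [pow_succ', ← mulVec_mulVec]
      exact (hstep _ ih).2
  exact (hstep _ (this t)).1

/-- The closed loop of the regulator gain is Schur stable. -/
theorem riccati_schurStable (hQ : Q.PosSemidef) (hR : R.PosDef) (hQA : Observable (psdSqrt Q) A)
    {P : Matrix (Fin n) (Fin n) ℝ} (hP : P.PosSemidef) (h : P = riccatiMap A B Q R P) :
    SchurStable (A - B * lqrGain A B R P) := by
  set K := lqrGain A B R P with hK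
  set M := A - B * K with hM
  set W := Q + Kᵀ * R * K with hW
  have hWp : W.PosSemidef := hQ.add (PosSemidef.conj hR.posSemidef _)
  have hlyap : P = W + Mᵀ * P * M := by
    conv_lhs => rw [h, riccatiMap_eq_lyapunov hR hP]
  set G := ∑ i ∈ Finset.range n, (M ^ i)ᵀ * W * M ^ i with hG
  have hGx : ∀ x, x ⬝ᵥ (G *ᵥ x) =
      ∑ i ∈ Finset.range n, ((M ^ i) *ᵥ x) ⬝ᵥ (W *ᵥ ((M ^ i) *ᵥ x)) := by
    intro x
    rw [hG, sum_mulVec, dotProduct_sum]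
    simp_rw [dotProduct_conj_mulVec]
  -- Where the `n`-step cost vanishes the feedback `K` is inactive, so closed-loop and open-loop
  -- orbits agree up to time `n` and observability of `(psdSqrt Q, A)` applies.
  have hGp : G.PosDef := by
    refine PosSemidef.posDef_of_ker (posSemidef_sum _ fun i _ => PosSemidef.conj hWp _)
      fun x hx => observable_iff.1 hQA x ?_
    have h0 : x ⬝ᵥ (G *ᵥ x) = 0 := by rw [hx, dotProduct_zero]
    rw [hGx, Finset.sum_eq_zero_iff_of_nonneg fun i _ => (posSemidef_iff_real.1 hWp).2 _] at h0
    have h1 : ∀ i < n, psdSqrt Q *ᵥ ((M ^ i) *ᵥ x) = 0 ∧ K *ᵥ ((M ^ i) *ᵥ x) = 0 := by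
      intro i hi
      have h2 := h0 i (Finset.mem_range.2 hi)
      set y := (M ^ i) *ᵥ x
      rw [hW, add_mulVec, dotProduct_add, dotProduct_conj_mulVec] at h2
      have h3 := (posSemidef_iff_real.1 hQ).2 y
      have h4 := (posSemidef_iff_real.1 hR.posSemidef).2 (K *ᵥ y)
      exact ⟨psdSqrt_mulVec_eq_zero hQ (by linarith), PosDef.mulVec_eq_zero hR (by linarith)⟩
    have h5 : ∀ i ≤ n, (M ^ i) *ᵥ x = (A ^ i) *ᵥ x := by
      intro i
      induction i with
      | zero => simp
      | succ i ih =>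
        intro hi
        have h6 := (h1 i hi).2
        rw [pow_succ', ← mulVec_mulVec, hM, sub_mulVec, ← mulVec_mulVec, ← hM, h6, mulVec_zero,
          sub_zero, ih (by omega), mulVec_mulVec, ← pow_succ']
    intro t ht
    rw [← h5 t ht.le]
    exact (h1 t ht).1
  refine schurStable_of_mulVec fun x => ?_
  have hdec : ∀ t : ℕ, ((M ^ t) *ᵥ x) ⬝ᵥ (W *ᵥ ((M ^ t) *ᵥ x)) =
      ((M ^ t) *ᵥ x) ⬝ᵥ (P *ᵥ ((M ^ t) *ᵥ x)) -
        ((M ^ (t + 1)) *ᵥ x) ⬝ᵥ (P *ᵥ ((M ^ (t + 1)) *ᵥ x)) := by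
    intro t
    rw [pow_succ', ← mulVec_mulVec]
    set y := (M ^ t) *ᵥ x
    have := congrArg (fun Z => y ⬝ᵥ (Z *ᵥ y)) hlyap
    simp only [add_mulVec W, dotProduct_add, dotProduct_conj_mulVec] at this
    linarith
  -- The stage costs telescope, so their sum is at most `xᵀ P x` and they tend to zero.
  have hW0 : Tendsto (fun t : ℕ => ((M ^ t) *ᵥ x) ⬝ᵥ (W *ᵥ ((M ^ t) *ᵥ x))) atTop (𝓝 0) := by
    refine (summable_of_sum_range_le (c := x ⬝ᵥ (P *ᵥ x))
      (fun t => (posSemidef_iff_real.1 hWp).2 _) fun t => ?_).tendsto_atTop_zero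
    simp_rw [hdec]
    rw [Finset.sum_range_sub']
    have := (posSemidef_iff_real.1 hP).2 ((M ^ t) *ᵥ x)
    simp only [pow_zero, one_mulVec]
    linarith
  have hG0 : Tendsto (fun t : ℕ => ((M ^ t) *ᵥ x) ⬝ᵥ (G *ᵥ ((M ^ t) *ᵥ x))) atTop (𝓝 0) := by
    simp_rw [hGx, mulVec_mulVec, ← pow_add]
    rw [← Finset.sum_const_zero (s := Finset.range n)]
    refine tendsto_finsetSum _ fun i _ => ?_
    have := hW0.comp (tendsto_add_atTop_nat i)
    simpa only [Function.comp_def, add_comm _ i, ← mulVec_mulVec] using this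
  -- An invertible factor of `G` turns convergence of the form into convergence of the vectors.
  obtain ⟨S, hSu, hS⟩ : ∃ S : Matrix (Fin n) (Fin n) ℝ, IsUnit S ∧ G = Sᵀ * S := by
    obtain ⟨S, hS⟩ : ∃ S : Matrix (Fin n) (Fin n) ℝ, G = Sᵀ * S := by
      refine ⟨psdSqrt G, ?_⟩
      rw [psdSqrt_transpose, psdSqrt_mul_self hGp.posSemidef]
    refine ⟨S, ?_, hS⟩
    have := hGp.isUnit
    rw [hS, isUnit_iff_isUnit_det, det_mul] at this
    exact (isUnit_iff_isUnit_det _).2 (isUnit_of_mul_isUnit_right this)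
  have hS0 : Tendsto (fun t : ℕ => S *ᵥ ((M ^ t) *ᵥ x)) atTop (𝓝 0) := by
    refine tendsto_pi_nhds.2 fun i => ?_
    have h1 : ∀ t : ℕ, (S *ᵥ ((M ^ t) *ᵥ x)) i ^ 2 ≤ ((M ^ t) *ᵥ x) ⬝ᵥ (G *ᵥ ((M ^ t) *ᵥ x)) := by
      intro t
      rw [hS, ← mulVec_mulVec, dotProduct_mulVec _ Sᵀ, vecMul_transpose, dotProduct, sq]
      exact Finset.single_le_sum (f := fun i => (S *ᵥ ((M ^ t) *ᵥ x)) i * (S *ᵥ ((M ^ t) *ᵥ x)) i)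
        (fun i _ => mul_self_nonneg _) (Finset.mem_univ i)
    have h2 := squeeze_zero (fun t => sq_nonneg _) h1 hG0
    change Tendsto _ _ (𝓝 (0 : ℝ))
    rw [tendsto_zero_iff_abs_tendsto_zero]
    have h3 := h2.sqrt
    simpa [Function.comp_def, Real.sqrt_sq_eq_abs] using h3
  have h4 : Continuous fun y : Fin n → ℝ => S⁻¹ *ᵥ y := by fun_prop
  have h5 := (h4.tendsto 0).comp hS0
  have h6 : S⁻¹ * S = 1 := nonsing_inv_mul _ ((isUnit_iff_isUnit_det _).1 hSu)
  simpa [Function.comp_def, mulVec_mulVec, ← Matrix.mul_assoc, h6] using h5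

/-- The difference satisfies `P - P' = (A - B K)ᵀ (P - P') (A - B K')` with the two different closed
loops, both stable. -/
theorem riccati_unique (hQ : Q.PosSemidef) (hR : R.PosDef) (hQA : Observable (psdSqrt Q) A)
    {P P' : Matrix (Fin n) (Fin n) ℝ} (hP : P.PosSemidef) (h : P = riccatiMap A B Q R P)
    (hP' : P'.PosSemidef) (h' : P' = riccatiMap A B Q R P') : P = P' := by
  set K := lqrGain A B R P with hK
  set K' := lqrGain A B R P' with hK'
  have hs := riccati_schurStable hQ hR hQA hP h
  have hs' := riccati_schurStable hQ hR hQA hP' h'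
  refine sub_eq_zero.1 (hs.transpose.eq_zero_of_eq_mul_mul hs' ?_)
  have e1 : (R + Bᵀ * P * B) * K = Bᵀ * P * A := mul_lqrGain hR hP
  have e2 : (R + Bᵀ * P' * B) * K' = Bᵀ * P' * A := mul_lqrGain hR hP'
  have e1' : Kᵀ * (R + Bᵀ * P * B) = Aᵀ * P * B := by
    have := congrArg transpose e1
    rwa [transpose_mul, PosDef.transpose_eq (posDef_add_conj hR hP B), transpose_mul, transpose_mul,
      transpose_transpose, PosSemidef.transpose_eq hP, ← Matrix.mul_assoc] at this
  have f1 : P = Q + Aᵀ * P * A - Aᵀ * P * B * K' + (Aᵀ * P * B * K' - Kᵀ * (Bᵀ * P * A)) := by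
    conv_lhs => rw [h, riccatiMap_eq hR hP, Matrix.mul_assoc _ _ (lqrGain A B R P), ← hK, e1]
    abel
  have f2 : P' = Q + Aᵀ * P' * A - Aᵀ * P' * B * K' := by
    conv_lhs => rw [h', riccatiMap]
    rw [hK', lqrGain]
    simp only [Matrix.mul_assoc]
  have f3 : Kᵀ * (R + Bᵀ * P * B) * K' = Aᵀ * P * B * K' := by rw [e1']
  have f4 : Kᵀ * ((R + Bᵀ * P' * B) * K') = Kᵀ * (Bᵀ * P' * A) := by rw [e2]
  -- `Kᵀ R K'` is computed from each of the two gain equations; equating the results matches the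
  -- cross terms.
  have f5 : Kᵀ * R * K' = Aᵀ * P * B * K' - Kᵀ * (Bᵀ * P * B) * K' := by
    rw [← f3, Matrix.mul_add, Matrix.add_mul, add_sub_cancel_right]
  have f6 : Kᵀ * R * K' = Kᵀ * (Bᵀ * P' * A) - Kᵀ * (Bᵀ * P' * B) * K' := by
    rw [← f4, Matrix.add_mul, Matrix.mul_add]
    simp only [Matrix.mul_assoc]
    abel
  have f7 := f5.symm.trans f6
  have f8 : Aᵀ * P * B * K' = Kᵀ * (Bᵀ * P' * A) - Kᵀ * (Bᵀ * P' * B) * K' +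
      Kᵀ * (Bᵀ * P * B) * K' := by rw [← f7]; abel
  conv_lhs => rw [f1, f2]
  conv_lhs => arg 1; arg 2; rw [f8]
  rw [← hK, ← hK', transpose_sub, transpose_mul]
  simp only [Matrix.mul_sub, Matrix.sub_mul, Matrix.mul_assoc]
  abel

/-- Value iterates are bounded by the cost of any admissible input. -/
theorem riccati_iterate_le (hQ : Q.PosSemidef) (hR : R.PosDef) (k : ℕ)
    (X : ℕ → Matrix (Fin n) (Fin n) ℝ) (U : ℕ → Matrix (Fin m) (Fin n) ℝ)
    (hX : ∀ t, X (t + 1) = A * X t + B * U t) :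
    (∑ t ∈ Finset.range k, ((X t)ᵀ * Q * X t + (U t)ᵀ * R * U t) -
      (X 0)ᵀ * (riccatiMap A B Q R)^[k] 0 * X 0).PosSemidef := by
  have hpsd : ∀ k, ((riccatiMap A B Q R)^[k] 0).PosSemidef := by
    intro k
    induction k with
    | zero => exact PosSemidef.zero
    | succ k ih =>
      rw [Function.iterate_succ_apply']
      exact riccatiMap_posSemidef hQ hR ih
  induction k generalizing X U with
  | zero => simpa using PosSemidef.zero
  | succ k ih =>
    rw [Finset.sum_range_succ', Function.iterate_succ_apply']
    -- Bellman's principle: the induction hypothesis handles the trajectory shifted by one step, and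
    -- completion of squares handles the first stage.
    have h1 := ih (fun t => X (t + 1)) (fun t => U (t + 1)) fun t => hX (t + 1)
    have h2 := riccati_completion (A := A) (B := B) (Q := Q) hR (hpsd k) (X 0) (U 0)
    rw [← hX 0] at h2
    have h3 := PosSemidef.conj (posDef_add_conj hR (hpsd k) B).posSemidef
      (U 0 + lqrGain A B R ((riccatiMap A B Q R)^[k] 0) * X 0)
    rw [eq_sub_of_add_eq' h2.symm] at h3
    convert! h1.add h3 using 1
    simp only [zero_add]
    abel

/-- Under reachability there is an input steering every initial state to the origin. -/
theorem Reachable.exists_deadbeat (hAB : Reachable A B) :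
    ∃ (X : ℕ → Matrix (Fin n) (Fin n) ℝ) (U : ℕ → Matrix (Fin m) (Fin n) ℝ),
      X 0 = 1 ∧ (∀ t, X (t + 1) = A * X t + B * U t) ∧
      (∀ t, n ≤ t → X t = 0 ∧ U t = 0) := by
  obtain ⟨G, hG⟩ := hAB.exists_eq_sum (A ^ n)
  -- Since `X n = A ^ n + ∑ A ^ (n - 1 - i) B U i`, cancelling the free response `A ^ n` takes the
  -- coefficients `G` in reverse order.
  let U : ℕ → Matrix (Fin m) (Fin n) ℝ := fun t => if t < n then - G (n - 1 - t) else 0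
  let X : ℕ → Matrix (Fin n) (Fin n) ℝ := fun t => Nat.rec 1 (fun t Y => A * Y + B * U t) t
  have hX : ∀ t, X (t + 1) = A * X t + B * U t := fun t => rfl
  have hcl : ∀ t, X t = A ^ t + ∑ i ∈ Finset.range t, A ^ (t - 1 - i) * B * U i := by
    intro t
    induction t with
    | zero => simp [X]
    | succ t ih =>
      rw [hX, ih, Finset.sum_range_succ, Matrix.mul_add, ← pow_succ', Finset.mul_sum, add_assoc]
      congr 2
      · refine Finset.sum_congr rfl fun i hi => ?_
        have hi' := Finset.mem_range.1 hi
        rw [← Matrix.mul_assoc, ← Matrix.mul_assoc, ← pow_succ']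
        congr 3
        omega
      · simp
  have hXn : X n = 0 := by
    rw [hcl, hG, ← Finset.sum_range_reflect (fun t => A ^ t * B * G t), ← Finset.sum_add_distrib]
    refine Finset.sum_eq_zero fun i hi => ?_
    simp [U, Finset.mem_range.1 hi]
  have hU : ∀ t, n ≤ t → U t = 0 := fun t ht => by simp [U, not_lt.2 ht]
  refine ⟨X, U, rfl, hX, fun t ht => ⟨?_, hU t ht⟩⟩
  induction t, ht using Nat.le_induction with
  | base => exact hXn
  | succ t ht ih => rw [hX, ih, hU t ht, Matrix.mul_zero, Matrix.mul_zero, add_zero]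

theorem continuousAt_riccatiMap (hR : R.PosDef) {P : Matrix (Fin n) (Fin n) ℝ}
    (hP : P.PosSemidef) : ContinuousAt (riccatiMap A B Q R) P := by
  have h1 : ContinuousAt (fun P : Matrix (Fin n) (Fin n) ℝ => (R + Bᵀ * P * B)⁻¹) P := by
    have hdet : (R + Bᵀ * P * B).det ≠ 0 := (posDef_add_conj hR hP B).det_pos.ne'
    have h2 : ContinuousAt Inv.inv (R + Bᵀ * P * B) := by
      apply continuousAt_matrix_inv
      simpa [Ring.inverse_eq_inv'] using continuousAt_inv₀ hdet
    have h3 : Continuous fun P : Matrix (Fin n) (Fin n) ℝ => R + Bᵀ * P * B := by fun_prop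
    exact ContinuousAt.comp (f := fun P : Matrix (Fin n) (Fin n) ℝ => R + Bᵀ * P * B) h2
      h3.continuousAt
  have h4 : ContinuousAt (fun p : Matrix (Fin n) (Fin n) ℝ × Matrix (Fin m) (Fin m) ℝ =>
      Q + Aᵀ * p.1 * A - Aᵀ * p.1 * B * p.2 * Bᵀ * p.1 * A) (P, (R + Bᵀ * P * B)⁻¹) := by
    have : Continuous (fun p : Matrix (Fin n) (Fin n) ℝ × Matrix (Fin m) (Fin m) ℝ =>
      Q + Aᵀ * p.1 * A - Aᵀ * p.1 * B * p.2 * Bᵀ * p.1 * A) := by fun_prop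
    exact this.continuousAt
  exact ContinuousAt.comp (f := fun P : Matrix (Fin n) (Fin n) ℝ => (P, (R + Bᵀ * P * B)⁻¹)) h4
    (continuousAt_id.prodMk h1)

theorem isClosed_posSemidef : IsClosed {P : Matrix (Fin n) (Fin n) ℝ | P.PosSemidef} := by
  simp only [posSemidef_iff_real, Set.ofPred_and, Set.ofPred_forall]
  refine (isClosed_eq (by fun_prop) continuous_id).inter (isClosed_iInter fun x => ?_)
  exact isClosed_le continuous_const (by fun_prop)

/-- Value iteration: the finite-horizon optimal costs `S k` increase with the horizon and are
bounded, and by continuity their limit is a fixed point. -/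
theorem exists_riccati (hQ : Q.PosSemidef) (hR : R.PosDef) (hAB : Reachable A B) :
    ∃ P : Matrix (Fin n) (Fin n) ℝ, P.PosSemidef ∧ P = riccatiMap A B Q R P := by
  set S : ℕ → Matrix (Fin n) (Fin n) ℝ := fun k => (riccatiMap A B Q R)^[k] 0 with hS
  have hsucc : ∀ k, S (k + 1) = riccatiMap A B Q R (S k) := fun k =>
    Function.iterate_succ_apply' _ _ _
  have hpsd : ∀ k, (S k).PosSemidef := by
    intro k
    induction k with
    | zero => exact PosSemidef.zero
    | succ k ih => rw [hsucc]; exact riccatiMap_posSemidef hQ hR ih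
  have hmono : ∀ k, (S (k + 1) - S k).PosSemidef := by
    intro k
    induction k with
    | zero => simpa [hS] using hpsd 1
    | succ k ih =>
      rw [hsucc (k + 1), hsucc k]
      refine riccatiMap_mono hR (hpsd k) ?_ ?_
      · rw [← hsucc]; exact hpsd _
      · rw [← hsucc]; exact ih
  obtain ⟨X, U, hX0, hX, hXU⟩ := hAB.exists_deadbeat
  set D := ∑ t ∈ Finset.range n, ((X t)ᵀ * Q * X t + (U t)ᵀ * R * U t) with hD
  -- The deadbeat trajectory is zero from time `n` on, so `D` is its cost over every horizon `k ≥
  -- n`.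
  have hbd : ∀ k, n ≤ k → (D - S k).PosSemidef := by
    intro k hk
    have h1 := riccati_iterate_le hQ hR k X U hX
    rw [hX0] at h1
    have h2 : D = ∑ t ∈ Finset.range k, ((X t)ᵀ * Q * X t + (U t)ᵀ * R * U t) := by
      refine Finset.sum_subset (Finset.range_mono hk) fun t _ ht => ?_
      have := hXU t (by simpa using ht)
      simp [this.1, this.2]
    rw [h2]
    simpa using h1
  have hq : ∀ x : Fin n → ℝ, ∃ l, Tendsto (fun k => x ⬝ᵥ (S k *ᵥ x)) atTop (𝓝 l) := by
    intro x
    have hm : Monotone fun k => x ⬝ᵥ (S k *ᵥ x) := by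
      refine monotone_nat_of_le_succ fun k => ?_
      have := (posSemidef_iff_real.1 (hmono k)).2 x
      rw [sub_mulVec, dotProduct_sub] at this
      linarith
    refine ⟨_, tendsto_atTop_ciSup hm ⟨x ⬝ᵥ (D *ᵥ x), ?_⟩⟩
    rintro _ ⟨k, rfl⟩
    refine (hm (le_max_left k n)).trans ?_
    have := (posSemidef_iff_real.1 (hbd _ (le_max_right k n))).2 x
    rw [sub_mulVec, dotProduct_sub] at this
    simpa using this
  choose l hl using hq
  -- Polarization recovers the entries of the limit from the limits of the quadratic forms.
  set P : Matrix (Fin n) (Fin n) ℝ := Matrix.of fun i j =>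
    (l (Pi.single i 1 + Pi.single j 1) - l (Pi.single i 1) - l (Pi.single j 1)) / 2 with hP
  have hlim : Tendsto S atTop (𝓝 P) := by
    refine tendsto_pi_nhds.2 fun i => tendsto_pi_nhds.2 fun j => ?_
    have h1 := (((hl (Pi.single i 1 + Pi.single j 1)).sub (hl (Pi.single i 1))).sub
      (hl (Pi.single j 1))).div_const 2
    refine Tendsto.congr (fun k => ?_) h1
    have h2 : S k j i = S k i j := by
      rw [← transpose_apply (S k), PosSemidef.transpose_eq (hpsd k)]
    simp [mulVec_add, h2]
    ring
  have hPp : P.PosSemidef := isClosed_posSemidef.mem_of_tendsto hlim (Eventually.of_forall hpsd)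
  refine ⟨P, hPp, tendsto_nhds_unique ((tendsto_add_atTop_iff_nat 1).2 hlim) ?_⟩
  simp_rw [hsucc]
  exact (continuousAt_riccatiMap hR hPp).tendsto.comp hlim

theorem existsUnique_solvesControlRiccati (hQ : Q.PosSemidef) (hR : R.PosDef)
    (hAB : Reachable A B) (hQA : Observable (psdSqrt Q) A) :
    ∃! P : Matrix (Fin n) (Fin n) ℝ, SolvesControlRiccati A B Q R P := by
  obtain ⟨P, hP, h⟩ := exists_riccati hQ hR hAB
  exact ⟨P, ⟨riccati_posDef hQ hR hQA hP h, h⟩, fun P' h' =>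
    riccati_unique hQ hR hQA h'.1.posSemidef h'.2 hP h⟩

theorem solvesFilterRiccati_iff {d : ℕ} {C : Matrix (Fin d) (Fin n) ℝ}
    {W : Matrix (Fin n) (Fin n) ℝ} {V : Matrix (Fin d) (Fin d) ℝ}
    {S : Matrix (Fin n) (Fin n) ℝ} :
    SolvesFilterRiccati A C W V S ↔ SolvesControlRiccati Aᵀ Cᵀ W V S := by
  simp only [SolvesFilterRiccati, SolvesControlRiccati, transpose_transpose, add_comm V]

theorem kalmanGain_eq {d : ℕ} {C : Matrix (Fin d) (Fin n) ℝ} {V : Matrix (Fin d) (Fin d) ℝ}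
    {S : Matrix (Fin n) (Fin n) ℝ} (hV : V.PosDef) (hS : S.PosSemidef) :
    kalmanGain A C V S = (lqrGain Aᵀ Cᵀ V S)ᵀ := by
  rw [lqrGain_transpose hV hS, kalmanGain, transpose_transpose, transpose_transpose,
    add_comm V]

end Riccati

end DLQR

namespace DLQR

open Matrix Filter Topology MeasureTheory

/-! ### The cost as a trace against a closed-loop Gramian. -/

section Cost

theorem SchurStable.hasSum_lyapunov {ι : Type*} [Fintype ι] [DecidableEq ι] {M : Matrix ι ι ℝ}
    (hM : SchurStable M) {P W : Matrix ι ι ℝ} (hP : P = W + Mᵀ * P * M) (hW : W.PosSemidef)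
    (x : ι → ℝ) :
    HasSum (fun t : ℕ => ((M ^ t) *ᵥ x) ⬝ᵥ (W *ᵥ ((M ^ t) *ᵥ x))) (x ⬝ᵥ (P *ᵥ x)) := by
  rw [hasSum_iff_tendsto_nat_of_nonneg fun t => (posSemidef_iff_real.1 hW).2 _]
  have hdec : ∀ t : ℕ, ((M ^ t) *ᵥ x) ⬝ᵥ (W *ᵥ ((M ^ t) *ᵥ x)) =
      ((M ^ t) *ᵥ x) ⬝ᵥ (P *ᵥ ((M ^ t) *ᵥ x)) -
        ((M ^ (t + 1)) *ᵥ x) ⬝ᵥ (P *ᵥ ((M ^ (t + 1)) *ᵥ x)) := by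
    intro t
    rw [pow_succ', ← mulVec_mulVec]
    set y := (M ^ t) *ᵥ x
    have := congrArg (fun Z => y ⬝ᵥ (Z *ᵥ y)) hP
    simp only [add_mulVec W, dotProduct_add, dotProduct_conj_mulVec] at this
    linarith
  simp_rw [hdec]
  simp_rw [Finset.sum_range_sub' fun t => ((M ^ t) *ᵥ x) ⬝ᵥ (P *ᵥ ((M ^ t) *ᵥ x))]
  have h3 : Continuous fun y : ι → ℝ => y ⬝ᵥ (P *ᵥ y) := by fun_prop
  have h4 := (h3.tendsto 0).comp (hM.mulVec x)
  simp only [zero_dotProduct] at h4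
  simpa using h4.const_sub (x ⬝ᵥ (P *ᵥ x))

/-- Both sides equal `tr (P S)` minus the same trace, up to a cyclic permutation; stability plays no
role. -/
theorem lyapunov_trace_duality {ι : Type*} [Fintype ι] {M P S W W' : Matrix ι ι ℝ}
    (hP : P = W + Mᵀ * P * M) (hS : S = W' + M * S * Mᵀ) : (P * W').trace = (W * S).trace := by
  have h1 : (P * W').trace = (P * S).trace - (P * (M * S * Mᵀ)).trace := by
    rw [← trace_sub, ← Matrix.mul_sub, eq_sub_of_add_eq hS.symm]
  have h2 : (W * S).trace = (P * S).trace - (Mᵀ * P * M * S).trace := by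
    rw [← trace_sub, ← Matrix.sub_mul, eq_sub_of_add_eq hP.symm]
  have h3 : (P * (M * S * Mᵀ)).trace = (Mᵀ * P * M * S).trace := by
    rw [← Matrix.mul_assoc, trace_mul_comm]
    simp only [Matrix.mul_assoc]
  rw [h1, h2, h3]

variable {n m d : ℕ}

/-- The weight `diag(Q, C_Kᵀ R C_K)` of the closed-loop stage cost. -/
def stageWeight (Q : Matrix (Fin n) (Fin n) ℝ) (R : Matrix (Fin m) (Fin m) ℝ)
    (K : Controller n m d) : Matrix (Fin n ⊕ Fin n) (Fin n ⊕ Fin n) ℝ :=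
  fromBlocks Q 0 0 (K.CKᵀ * R * K.CK)

/-- The second moment `diag(X, B_K V B_Kᵀ)` of the closed-loop initial state. -/
def initMoment (X : Matrix (Fin n) (Fin n) ℝ) (V : Matrix (Fin d) (Fin d) ℝ)
    (K : Controller n m d) : Matrix (Fin n ⊕ Fin n) (Fin n ⊕ Fin n) ℝ :=
  fromBlocks X 0 0 (K.BK * V * K.BKᵀ)

/-- The transposed controller `(A_Kᵀ, C_Kᵀ, B_Kᵀ)` of the dual system. -/
def dualController (K : Controller n m d) : Controller n d m := (K.AKᵀ, K.CKᵀ, K.BKᵀ)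

theorem initMoment_eq_stageWeight (X : Matrix (Fin n) (Fin n) ℝ) (V : Matrix (Fin d) (Fin d) ℝ)
    (K : Controller n m d) : initMoment X V K = stageWeight X V (dualController K) := by
  simp [initMoment, stageWeight, dualController, Controller.CK]

theorem closedLoop_dual (A : Matrix (Fin n) (Fin n) ℝ) (B : Matrix (Fin n) (Fin m) ℝ)
    (C : Matrix (Fin d) (Fin n) ℝ) (K : Controller n m d) :
    closedLoop Aᵀ Cᵀ Bᵀ (dualController K) = (closedLoop A B C K)ᵀ := by
  simp [closedLoop, dualController, fromBlocks_transpose]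

theorem stageWeight_posSemidef {Q : Matrix (Fin n) (Fin n) ℝ} {R : Matrix (Fin m) (Fin m) ℝ}
    (hQ : Q.PosSemidef) (hR : R.PosSemidef) (K : Controller n m d) :
    (stageWeight Q R K).PosSemidef := by
  have h1 : (K.CKᵀ * R * K.CK).PosSemidef := PosSemidef.conj hR _
  refine posSemidef_iff_real.2 ⟨?_, fun x => ?_⟩
  · rw [stageWeight, fromBlocks_transpose, PosSemidef.transpose_eq hQ, PosSemidef.transpose_eq h1]
    simp
  · rw [stageWeight, fromBlocks_mulVec, ← Sum.elim_comp_inl_inr x, sumElim_dotProduct_sumElim]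
    have h2 := (posSemidef_iff_real.1 hQ).2 (x ∘ Sum.inl)
    have h3 := (posSemidef_iff_real.1 h1).2 (x ∘ Sum.inr)
    simpa using add_nonneg h2 h3

theorem mem_stabilizing_iff {A : Matrix (Fin n) (Fin n) ℝ} {B : Matrix (Fin n) (Fin m) ℝ}
    {C : Matrix (Fin d) (Fin n) ℝ} {K : Controller n m d} :
    K ∈ stabilizing A B C ↔ SchurStable (closedLoop A B C K) :=
  schurStable_iff_spectralRadius _

theorem trajectory_eq (A : Matrix (Fin n) (Fin n) ℝ) (B : Matrix (Fin n) (Fin m) ℝ)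
    (C : Matrix (Fin d) (Fin n) ℝ) (K : Controller n m d) (x₀ ξ₀ : Fin n → ℝ) (t : ℕ) :
    Sum.elim (trajectory A B C K x₀ ξ₀ t).1 (trajectory A B C K x₀ ξ₀ t).2 =
      (closedLoop A B C K ^ t) *ᵥ Sum.elim x₀ ξ₀ := by
  induction t with
  | zero => simp [trajectory]
  | succ t ih =>
    rw [pow_succ', ← mulVec_mulVec, ← ih, closedLoop, fromBlocks_mulVec]
    simp [trajectory, mulVec_mulVec, add_comm]

theorem trajectoryCost_eq {A : Matrix (Fin n) (Fin n) ℝ} {B : Matrix (Fin n) (Fin m) ℝ}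
    {C : Matrix (Fin d) (Fin n) ℝ} {Q : Matrix (Fin n) (Fin n) ℝ} {R : Matrix (Fin m) (Fin m) ℝ}
    (hQ : Q.PosSemidef) (hR : R.PosSemidef) {K : Controller n m d}
    (hK : K ∈ stabilizing A B C) {P : Matrix (Fin n ⊕ Fin n) (Fin n ⊕ Fin n) ℝ}
    (hP : P = stageWeight Q R K + (closedLoop A B C K)ᵀ * P * closedLoop A B C K)
    (x₀ ξ₀ : Fin n → ℝ) :
    trajectoryCost A B C Q R K x₀ ξ₀ = Sum.elim x₀ ξ₀ ⬝ᵥ (P *ᵥ Sum.elim x₀ ξ₀) := by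
  rw [← ((mem_stabilizing_iff.1 hK).hasSum_lyapunov hP (stageWeight_posSemidef hQ hR K)
    (Sum.elim x₀ ξ₀)).tsum_eq, trajectoryCost]
  refine tsum_congr fun t => ?_
  rw [← trajectory_eq, stageWeight, fromBlocks_mulVec, sumElim_dotProduct_sumElim]
  simp only [Sum.elim_comp_inl, Sum.elim_comp_inr, zero_mulVec, add_zero, zero_add,
    dotProduct_conj_mulVec]

/-! ### Expectations of quadratic forms. -/

section Expectation

variable {Ω : Type*} [MeasurableSpace Ω] {μ : Measure Ω}

theorem integral_dotProduct_mulVec {ι : Type*} [Fintype ι] {z : Ω → ι → ℝ}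
    (hz : ∀ i, MemLp (fun ω => z ω i) 2 μ) {W : Matrix ι ι ℝ}
    (hW : ∀ i j, ∫ ω, z ω i * z ω j ∂μ = W i j) (P : Matrix ι ι ℝ) :
    ∫ ω, z ω ⬝ᵥ (P *ᵥ z ω) ∂μ = (P * W).trace := by
  have hint : ∀ i j, Integrable (fun ω => z ω i * z ω j) μ := fun i j => (hz i).integrable_mul (hz j)
  have h1 : ∀ ω, z ω ⬝ᵥ (P *ᵥ z ω) = ∑ i, ∑ j, P i j * (z ω j * z ω i) := by
    intro ω
    simp only [dotProduct, mulVec, Finset.mul_sum]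
    refine Finset.sum_congr rfl fun i _ => Finset.sum_congr rfl fun j _ => by ring
  have hint' : ∀ i j, Integrable (fun ω => P i j * (z ω j * z ω i)) μ := fun i j =>
    (hint j i).const_mul (P i j)
  have h2 : ∫ ω, ∑ i, ∑ j, P i j * (z ω j * z ω i) ∂μ =
      ∑ i, ∫ ω, ∑ j, P i j * (z ω j * z ω i) ∂μ :=
    integral_finsetSum _ fun i _ => integrable_finsetSum _ fun j _ => hint' i j
  have h3 : ∀ i, ∫ ω, ∑ j, P i j * (z ω j * z ω i) ∂μ =
      ∑ j, ∫ ω, P i j * (z ω j * z ω i) ∂μ := fun i =>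
    integral_finsetSum _ fun j _ => hint' i j
  simp_rw [h1, h2, h3, integral_const_mul, hW]
  simp [trace, mul_apply]

theorem secondMoment_posSemidef {x : Ω → Fin n → ℝ} (hx : MemLp x 2 μ) :
    (secondMoment μ x x).PosSemidef := by
  refine posSemidef_iff_real.2 ⟨?_, fun v => ?_⟩
  · ext i j
    simp [secondMoment, mul_comm]
  -- The rank-one weight `v vᵀ` turns the form of the second moment into the expectation of a
  -- square.
  · have h1 := integral_dotProduct_mulVec (z := x) (W := secondMoment μ x x) (fun i => hx.eval i)
      (fun i j => rfl) (vecMulVec v v)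
    have h2 : (vecMulVec v v * secondMoment μ x x).trace = v ⬝ᵥ (secondMoment μ x x *ᵥ v) := by
      rw [vecMulVec_mul, trace_vecMulVec, dotProduct_mulVec, dotProduct_comm]
    rw [← h2, ← h1]
    refine integral_nonneg fun ω => ?_
    have : x ω ⬝ᵥ (vecMulVec v v *ᵥ x ω) = (v ⬝ᵥ x ω) * (v ⬝ᵥ x ω) := by
      rw [vecMulVec_mulVec]
      simp [dotProduct_comm]
    change 0 ≤ x ω ⬝ᵥ (vecMulVec v v *ᵥ x ω)
    rw [this]
    exact mul_self_nonneg _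

theorem cost_eq_trace {A : Matrix (Fin n) (Fin n) ℝ} {B : Matrix (Fin n) (Fin m) ℝ}
    {C : Matrix (Fin d) (Fin n) ℝ} {Q : Matrix (Fin n) (Fin n) ℝ} {R : Matrix (Fin m) (Fin m) ℝ}
    (hQ : Q.PosSemidef) (hR : R.PosSemidef) {x₀ : Ω → Fin n → ℝ} {s : Ω → Fin d → ℝ}
    (hx₀ : MemLp x₀ 2 μ) (hs : MemLp s 2 μ) (hx₀s : secondMoment μ x₀ s = 0)
    {K : Controller n m d} (hK : K ∈ stabilizing A B C)
    {P : Matrix (Fin n ⊕ Fin n) (Fin n ⊕ Fin n) ℝ}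
    (hP : P = stageWeight Q R K + (closedLoop A B C K)ᵀ * P * closedLoop A B C K) :
    cost A B C Q R μ x₀ s K =
      (P * initMoment (secondMoment μ x₀ x₀) (secondMoment μ s s) K).trace := by
  unfold cost
  simp_rw [trajectoryCost_eq hQ hR hK hP]
  have hBs : ∀ i, MemLp (fun ω => (K.BK *ᵥ s ω) i) 2 μ := by
    intro i
    simp only [mulVec, dotProduct]
    exact memLp_finsetSum _ fun k _ => (hs.eval k).const_mul _
  -- Uncorrelated `x₀` and `s` make the initial second moment block diagonal.
  have hxs : ∀ i j, ∫ ω, x₀ ω i * (K.BK *ᵥ s ω) j ∂μ = 0 := by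
    intro i j
    simp only [mulVec, dotProduct, Finset.mul_sum]
    have h0 : ∀ k, ∫ ω, x₀ ω i * s ω k ∂μ = 0 := fun k => congrFun (congrFun hx₀s i) k
    rw [integral_finsetSum]
    · refine Finset.sum_eq_zero fun k _ => ?_
      simp_rw [mul_left_comm _ (K.BK j k)]
      rw [integral_const_mul, h0, mul_zero]
    · intro k _
      simp_rw [mul_left_comm _ (K.BK j k)]
      exact ((hx₀.eval i).integrable_mul (hs.eval k)).const_mul _
  have hss : ∀ i j, ∫ ω, (K.BK *ᵥ s ω) i * (K.BK *ᵥ s ω) j ∂μ =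
      (K.BK * secondMoment μ s s * K.BKᵀ) i j := by
    intro i j
    have h1 := integral_dotProduct_mulVec (z := s) (W := secondMoment μ s s) (fun i => hs.eval i)
      (fun i j => rfl) (vecMulVec (K.BK j) (K.BK i))
    have h2 : (vecMulVec (K.BK j) (K.BK i) * secondMoment μ s s).trace =
        (K.BK * secondMoment μ s s * K.BKᵀ) i j := by
      rw [vecMulVec_mul, trace_vecMulVec, dotProduct_comm]
      rfl
    rw [← h2, ← h1]
    refine integral_congr_ae (Eventually.of_forall fun ω => ?_)
    change _ = s ω ⬝ᵥ (vecMulVec (K.BK j) (K.BK i) *ᵥ s ω)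
    rw [vecMulVec_mulVec]
    simp [mulVec, dotProduct_comm]
  refine integral_dotProduct_mulVec ?_ ?_ P
  · rintro (i | i)
    · exact hx₀.eval i
    · exact hBs i
  · rintro (i | i) (j | j)
    · rfl
    · exact hxs i j
    · simp only [Sum.elim_inl, Sum.elim_inr, initMoment, fromBlocks_apply₂₁, Matrix.zero_apply]
      simp_rw [mul_comm _ (x₀ _ j)]
      exact hxs j i
    · exact hss i j

end Expectation

/-! ### Invariance under similarity transformations. -/

theorem trajectory_similarity (A : Matrix (Fin n) (Fin n) ℝ) (B : Matrix (Fin n) (Fin m) ℝ)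
    (C : Matrix (Fin d) (Fin n) ℝ) (K : Controller n m d) (T : GL (Fin n) ℝ) (x₀ ξ₀ : Fin n → ℝ)
    (t : ℕ) :
    trajectory A B C (K.similarity T) x₀ ((T : Matrix (Fin n) (Fin n) ℝ) *ᵥ ξ₀) t =
      ((trajectory A B C K x₀ ξ₀ t).1,
        (T : Matrix (Fin n) (Fin n) ℝ) *ᵥ (trajectory A B C K x₀ ξ₀ t).2) := by
  have hT : ((T⁻¹ : GL (Fin n) ℝ) : Matrix (Fin n) (Fin n) ℝ) * (T : Matrix (Fin n) (Fin n) ℝ) = 1 :=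
    T.inv_mul
  induction t with
  | zero => rfl
  | succ t ih =>
    rw [trajectory, ih]
    simp only [trajectory, Controller.similarity, Controller.CK, Controller.AK, Controller.BK,
      mulVec_mulVec, Matrix.mul_assoc, hT, Matrix.mul_one, mulVec_add]

/-- The initial estimate `B_K s` is transformed together with the controller, so the plant state and
the input are unchanged path by path. -/
theorem cost_similarity (A : Matrix (Fin n) (Fin n) ℝ) (B : Matrix (Fin n) (Fin m) ℝ)
    (C : Matrix (Fin d) (Fin n) ℝ) (Q : Matrix (Fin n) (Fin n) ℝ) (R : Matrix (Fin m) (Fin m) ℝ)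
    {Ω : Type*} [MeasurableSpace Ω] (μ : Measure Ω) (x₀ : Ω → Fin n → ℝ) (s : Ω → Fin d → ℝ)
    (K : Controller n m d) (T : GL (Fin n) ℝ) :
    cost A B C Q R μ x₀ s (K.similarity T) = cost A B C Q R μ x₀ s K := by
  have hT : ((T⁻¹ : GL (Fin n) ℝ) : Matrix (Fin n) (Fin n) ℝ) * (T : Matrix (Fin n) (Fin n) ℝ) = 1 :=
    T.inv_mul
  unfold cost trajectoryCost
  have h1 : ∀ ω, (K.similarity T).BK *ᵥ s ω =
      (T : Matrix (Fin n) (Fin n) ℝ) *ᵥ (K.BK *ᵥ s ω) := fun ω => by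
    rw [mulVec_mulVec]; rfl
  have h2 : ∀ v, (K.similarity T).CK *ᵥ ((T : Matrix (Fin n) (Fin n) ℝ) *ᵥ v) = K.CK *ᵥ v := by
    intro v
    simp only [Controller.similarity, Controller.CK, mulVec_mulVec, Matrix.mul_assoc, hT,
      Matrix.mul_one]
  simp_rw [h1, trajectory_similarity, h2]

theorem similarity_mem_stabilizing {A : Matrix (Fin n) (Fin n) ℝ} {B : Matrix (Fin n) (Fin m) ℝ}
    {C : Matrix (Fin d) (Fin n) ℝ} {K : Controller n m d} (hK : K ∈ stabilizing A B C)
    (T : GL (Fin n) ℝ) : K.similarity T ∈ stabilizing A B C := by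
  have hT : ((T⁻¹ : GL (Fin n) ℝ) : Matrix (Fin n) (Fin n) ℝ) * (T : Matrix (Fin n) (Fin n) ℝ) = 1 :=
    T.inv_mul
  rw [mem_stabilizing_iff] at *
  have h1 : closedLoop A B C (K.similarity T) =
      fromBlocks 1 0 0 (T : Matrix (Fin n) (Fin n) ℝ) * closedLoop A B C K *
        fromBlocks 1 0 0 ((T⁻¹ : GL (Fin n) ℝ) : Matrix (Fin n) (Fin n) ℝ) := by
    simp [closedLoop, fromBlocks_multiply, Controller.similarity, Controller.AK, Controller.BK,
      Controller.CK, Matrix.mul_assoc]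
  rw [h1]
  refine hK.conj ?_
  rw [fromBlocks_multiply, hT]
  simp

theorem similarity_similarity_inv (K : Controller n m d) (T : GL (Fin n) ℝ) :
    (K.similarity T).similarity T⁻¹ = K := by
  have hT : ((T⁻¹ : GL (Fin n) ℝ) : Matrix (Fin n) (Fin n) ℝ) * (T : Matrix (Fin n) (Fin n) ℝ) = 1 :=
    T.inv_mul
  refine Prod.ext ?_ (Prod.ext ?_ ?_)
  · simp only [Controller.similarity, Controller.AK, inv_inv, Matrix.mul_assoc, hT, Matrix.mul_one]
    rw [← Matrix.mul_assoc, hT, Matrix.one_mul]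
  · simp only [Controller.similarity, Controller.BK, ← Matrix.mul_assoc, hT, Matrix.one_mul]
  · simp only [Controller.similarity, Controller.CK, inv_inv, Matrix.mul_assoc, hT, Matrix.mul_one]

theorem Observable.conj {C : Matrix (Fin d) (Fin n) ℝ} {A : Matrix (Fin n) (Fin n) ℝ}
    (h : Observable C A) {T T' : Matrix (Fin n) (Fin n) ℝ} (hT : T' * T = 1) :
    Observable (C * T') (T * A * T') := by
  rw [observable_iff] at *
  have hT' : T * T' = 1 := mul_eq_one_comm.1 hT
  have h1 : ∀ t : ℕ, C * T' * (T * A * T') ^ t = C * A ^ t * T' := by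
    intro t
    induction t with
    | zero => simp
    | succ t ih =>
      rw [pow_succ, ← Matrix.mul_assoc, ih, pow_succ]
      simp only [Matrix.mul_assoc]
      rw [← Matrix.mul_assoc T' T, hT, Matrix.one_mul]
  intro x hx
  have h2 := h (T' *ᵥ x) fun t ht => by
    have := hx t ht
    rw [mulVec_mulVec, h1] at this
    rwa [mulVec_mulVec, mulVec_mulVec]
  have h3 := congrArg (T *ᵥ ·) h2
  simpa [mulVec_mulVec, hT'] using h3

theorem Controller.IsMinimal.similarity {K : Controller n m d} (h : K.IsMinimal)
    (T : GL (Fin n) ℝ) : (K.similarity T).IsMinimal := by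
  have hT : ((T⁻¹ : GL (Fin n) ℝ) : Matrix (Fin n) (Fin n) ℝ) * (T : Matrix (Fin n) (Fin n) ℝ) = 1 :=
    T.inv_mul
  have hT' : (T : Matrix (Fin n) (Fin n) ℝ) * ((T⁻¹ : GL (Fin n) ℝ) : Matrix (Fin n) (Fin n) ℝ) = 1 :=
    T.mul_inv
  refine ⟨h.1.conj hT, ?_⟩
  rw [reachable_iff_observable]
  have := (reachable_iff_observable.1 h.2).conj
    (T := ((T⁻¹ : GL (Fin n) ℝ) : Matrix (Fin n) (Fin n) ℝ)ᵀ)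
    (T' := (T : Matrix (Fin n) (Fin n) ℝ)ᵀ) (by rw [← transpose_mul, hT, transpose_one])
  simpa [Controller.similarity, Controller.AK, Controller.BK, transpose_mul,
    Matrix.mul_assoc] using this

end Cost

end DLQR

namespace DLQR

open Matrix Filter Topology

/-! ### Global optimality of the observer-based controller. -/

section Optimality

variable {n m d : ℕ} {A : Matrix (Fin n) (Fin n) ℝ} {B : Matrix (Fin n) (Fin m) ℝ}
  {C : Matrix (Fin d) (Fin n) ℝ} {Q : Matrix (Fin n) (Fin n) ℝ} {R : Matrix (Fin m) (Fin m) ℝ}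
  {X : Matrix (Fin n) (Fin n) ℝ} {V : Matrix (Fin d) (Fin d) ℝ}

/-- On the stabilizing set, `J` is given by the closed-loop state covariance `S` as
`trace (diag(Q, C_Kᵀ R C_K) S)`. -/
def IsGramianCost (A : Matrix (Fin n) (Fin n) ℝ) (B : Matrix (Fin n) (Fin m) ℝ)
    (C : Matrix (Fin d) (Fin n) ℝ) (Q : Matrix (Fin n) (Fin n) ℝ) (R : Matrix (Fin m) (Fin m) ℝ)
    (X : Matrix (Fin n) (Fin n) ℝ) (V : Matrix (Fin d) (Fin d) ℝ)
    (J : Controller n m d → ℝ) : Prop :=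
  ∀ K ∈ stabilizing A B C, ∀ S : Matrix (Fin n ⊕ Fin n) (Fin n ⊕ Fin n) ℝ,
    S = initMoment X V K + closedLoop A B C K * S * (closedLoop A B C K)ᵀ →
    J K = (stageWeight Q R K * S).trace

theorem trace_posSemidef_mul_conj_nonneg {k : ℕ} {ι : Type*} [Fintype ι]
    {H : Matrix (Fin k) (Fin k) ℝ} (hH : H.PosSemidef) {D : Matrix ι ι ℝ} (hD : D.PosSemidef)
    (G : Matrix (Fin k) ι ℝ) : 0 ≤ (H * (G * D * Gᵀ)).trace := by
  have h1 : (H * (G * D * Gᵀ)).trace = (psdSqrt H * (G * D * Gᵀ) * (psdSqrt H)ᵀ).trace := by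
    rw [psdSqrt_transpose, trace_mul_comm _ (psdSqrt H), ← Matrix.mul_assoc (psdSqrt H),
      psdSqrt_mul_self hH]
  rw [h1]
  exact (PosSemidef.conj' (PosSemidef.conj' hD G) _).trace_nonneg

/-- Completion of squares with state and input as linear functions `E = [1 0]`, `U = [0 C_K]` of the
closed-loop state; `A E + B U` is the top block row of the closed-loop matrix. At a Riccati
solution, `diag(P, 0)` thus solves the cost Lyapunov equation up to a square. -/
theorem stageWeight_completion (hR : R.PosDef) {P : Matrix (Fin n) (Fin n) ℝ} (hP : P.PosSemidef)
    (K : Controller n m d) :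
    stageWeight Q R K + (closedLoop A B C K)ᵀ * fromBlocks P 0 0 0 * closedLoop A B C K =
      fromBlocks (riccatiMap A B Q R P) 0 0 0 + (fromCols (lqrGain A B R P) K.CK)ᵀ *
        (R + Bᵀ * P * B) * fromCols (lqrGain A B R P) K.CK := by
  obtain ⟨E, hE⟩ : ∃ E : Matrix (Fin n) (Fin n ⊕ Fin n) ℝ, E = fromCols 1 0 := ⟨_, rfl⟩
  obtain ⟨U, hU⟩ : ∃ U : Matrix (Fin m) (Fin n ⊕ Fin n) ℝ, U = fromCols 0 K.CK := ⟨_, rfl⟩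
  have h := riccati_completion (A := A) (B := B) (Q := Q) hR hP E U
  have hE' : ∀ Z : Matrix (Fin n) (Fin n) ℝ, Eᵀ * Z * E = fromBlocks Z 0 0 0 := by
    intro Z
    rw [hE, transpose_fromCols, fromRows_mul, fromRows_mul_fromCols]
    simp
  have hU' : Uᵀ * R * U = fromBlocks 0 0 0 (K.CKᵀ * R * K.CK) := by
    rw [hU, transpose_fromCols, fromRows_mul, fromRows_mul_fromCols]
    simp
  have hA : A * E + B * U = E * closedLoop A B C K := by
    rw [hE, hU, closedLoop, fromCols_mul_fromBlocks, mul_fromCols, mul_fromCols]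
    ext i (j | j) <;> simp
  have hG : U + lqrGain A B R P * E = fromCols (lqrGain A B R P) K.CK := by
    rw [hE, hU, mul_fromCols]
    ext i (j | j) <;> simp
  rw [hE', hU', hA, hG, hE', fromBlocks_add] at h
  rw [← h, stageWeight, transpose_mul, ← hE']
  simp only [add_zero, zero_add, Matrix.mul_assoc]

theorem initMoment_completion (hV : V.PosDef) {S : Matrix (Fin n) (Fin n) ℝ} (hS : S.PosSemidef)
    (K : Controller n m d) :
    initMoment X V K + closedLoop A B C K * fromBlocks S 0 0 0 * (closedLoop A B C K)ᵀ =
      fromBlocks (riccatiMap Aᵀ Cᵀ X V S) 0 0 0 + fromRows (kalmanGain A C V S) K.BK *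
        (C * S * Cᵀ + V) * (fromRows (kalmanGain A C V S) K.BK)ᵀ := by
  have h := stageWeight_completion (A := Aᵀ) (B := Cᵀ) (C := Bᵀ) (Q := X) hV hS
    (dualController K)
  rw [← initMoment_eq_stageWeight, closedLoop_dual, transpose_transpose] at h
  rw [h, kalmanGain_eq hV hS, transpose_fromCols, transpose_fromRows, transpose_transpose,
    transpose_transpose, add_comm V]
  simp [dualController, Controller.CK]

/-- The cost of a stabilizing controller is the sum of a constant, attained by the optimal
observer-based controller, and a nonnegative term. -/
theorem IsGramianCost.eq_add {J : Controller n m d → ℝ} (hJ : IsGramianCost A B C Q R X V J)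
    (hR : R.PosDef) (hV : V.PosDef)
    {P S : Matrix (Fin n) (Fin n) ℝ} (hP : SolvesControlRiccati A B Q R P)
    (hS : SolvesFilterRiccati A C X V S) {K : Controller n m d} (hK : K ∈ stabilizing A B C)
    {D : Matrix (Fin n ⊕ Fin n) (Fin n ⊕ Fin n) ℝ}
    (hD : D = fromRows (kalmanGain A C V S) K.BK * (C * S * Cᵀ + V) *
      (fromRows (kalmanGain A C V S) K.BK)ᵀ + closedLoop A B C K * D * (closedLoop A B C K)ᵀ) :
    J K = (P * X).trace +
      ((R + Bᵀ * P * B) * (lqrGain A B R P * S * (lqrGain A B R P)ᵀ)).trace +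
      ((R + Bᵀ * P * B) * (fromCols (lqrGain A B R P) K.CK * D *
        (fromCols (lqrGain A B R P) K.CK)ᵀ)).trace := by
  set M := closedLoop A B C K
  set G := fromCols (lqrGain A B R P) K.CK
  set L := fromRows (kalmanGain A C V S) K.BK
  set H := R + Bᵀ * P * B
  have hPr : riccatiMap A B Q R P = P := hP.2.symm
  have hSr : riccatiMap Aᵀ Cᵀ X V S = S := (solvesFilterRiccati_iff.1 hS).2.symm
  have e1 := stageWeight_completion (A := A) (B := B) (C := C) (Q := Q) hR hP.1.posSemidef K
  have e2 := initMoment_completion (A := A) (B := B) (C := C) (X := X) hV hS.1.posSemidef K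
  rw [hPr] at e1
  rw [hSr] at e2
  -- The closed-loop covariance splits into `diag(S, 0)` and the remainder `D`, which is driven by
  -- the square left over in `e2`.
  have e3 : (fromBlocks S 0 0 0 : Matrix (Fin n ⊕ Fin n) (Fin n ⊕ Fin n) ℝ) + D = initMoment X V K + M * (fromBlocks S 0 0 0 + D) * Mᵀ := by
    rw [Matrix.mul_add, Matrix.add_mul, ← add_assoc, e2, add_assoc, ← hD]
  have e4 : (fromBlocks P 0 0 0 : Matrix (Fin n ⊕ Fin n) (Fin n ⊕ Fin n) ℝ) =
      (stageWeight Q R K - Gᵀ * H * G) + Mᵀ * fromBlocks P 0 0 0 * M := by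
    rw [sub_add_eq_add_sub, e1, add_sub_cancel_right]
  have e5 := lyapunov_trace_duality e4 e3
  have e6 : (fromBlocks P 0 0 0 * initMoment X V K).trace = (P * X).trace := by
    rw [initMoment, fromBlocks_multiply]
    simp [trace, Fintype.sum_sum_type]
  have e7 : (Gᵀ * H * G * (fromBlocks S 0 0 0 + D)).trace =
      (H * (lqrGain A B R P * S * (lqrGain A B R P)ᵀ)).trace + (H * (G * D * Gᵀ)).trace := by
    have e8 : G * (fromBlocks S 0 0 0 : Matrix (Fin n ⊕ Fin n) (Fin n ⊕ Fin n) ℝ) * Gᵀ = lqrGain A B R P * S * (lqrGain A B R P)ᵀ := by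
      rw [fromCols_mul_fromBlocks, transpose_fromCols, fromCols_mul_fromRows]
      simp
    rw [← trace_add, ← Matrix.mul_add, ← e8, ← Matrix.add_mul, ← Matrix.mul_add,
      Matrix.mul_assoc, Matrix.mul_assoc, trace_mul_comm]
    simp only [Matrix.mul_assoc]
  rw [e6, Matrix.sub_mul, trace_sub, e7] at e5
  rw [hJ K hK _ e3]
  linarith

/-- The observer-based controller built from the two Riccati solutions. -/
noncomputable def lqgController (A : Matrix (Fin n) (Fin n) ℝ) (B : Matrix (Fin n) (Fin m) ℝ)
    (C : Matrix (Fin d) (Fin n) ℝ) (R : Matrix (Fin m) (Fin m) ℝ) (V : Matrix (Fin d) (Fin d) ℝ)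
    (P S : Matrix (Fin n) (Fin n) ℝ) : Controller n m d :=
  observerController A B C (lqrGain A B R P) (kalmanGain A C V S)

theorem kalman_schurStable (hX : X.PosSemidef) (hV : V.PosDef) (hAX : Reachable A (psdSqrt X))
    {S : Matrix (Fin n) (Fin n) ℝ} (hS : SolvesFilterRiccati A C X V S) :
    SchurStable (A - kalmanGain A C V S * C) := by
  rw [reachable_iff_observable, psdSqrt_transpose] at hAX
  have h := solvesFilterRiccati_iff.1 hS
  have := (riccati_schurStable hX hV hAX h.1.posSemidef h.2).transpose
  rwa [transpose_sub, transpose_mul, transpose_transpose, transpose_transpose,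
    ← kalmanGain_eq hV hS.1.posSemidef] at this

/-- In the coordinates `(x, x - ξ)`, given by an involution, the closed loop is block triangular
with diagonal `A - B F`, `A - L C`. -/
theorem observerController_mem_stabilizing {F : Matrix (Fin m) (Fin n) ℝ}
    {L : Matrix (Fin n) (Fin d) ℝ} (hF : SchurStable (A - B * F)) (hL : SchurStable (A - L * C)) :
    observerController A B C F L ∈ stabilizing A B C := by
  rw [mem_stabilizing_iff]
  have h1 := (schurStable_fromBlocks_zero₂₁ hF hL (B * F)).conj
    (T := fromBlocks 1 0 1 (-1)) (T' := fromBlocks 1 0 1 (-1))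
    (by rw [fromBlocks_multiply, ← fromBlocks_one]; simp)
  convert! h1 using 1
  simp only [closedLoop, observerController, Controller.CK, Controller.BK, Controller.AK,
    fromBlocks_multiply, Matrix.one_mul, Matrix.mul_one, Matrix.zero_mul, Matrix.mul_zero,
    Matrix.neg_mul, Matrix.mul_neg, add_zero, zero_add]
  congr 1 <;> abel

theorem lqgController_mem_stabilizing (hQ : Q.PosSemidef) (hR : R.PosDef) (hX : X.PosSemidef)
    (hV : V.PosDef) (hQA : Observable (psdSqrt Q) A) (hAX : Reachable A (psdSqrt X))
    {P S : Matrix (Fin n) (Fin n) ℝ} (hP : SolvesControlRiccati A B Q R P)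
    (hS : SolvesFilterRiccati A C X V S) : lqgController A B C R V P S ∈ stabilizing A B C :=
  observerController_mem_stabilizing (riccati_schurStable hQ hR hQA hP.1.posSemidef hP.2)
    (kalman_schurStable hX hV hAX hS)

/-- The excess term in `IsGramianCost.eq_add` is nonnegative for every stabilizing controller and
zero for this one. -/
theorem IsGramianCost.isMinOn_lqgController {J : Controller n m d → ℝ}
    (hJ : IsGramianCost A B C Q R X V J)
    (hQ : Q.PosSemidef) (hR : R.PosDef) (hX : X.PosSemidef)
    (hV : V.PosDef) (hQA : Observable (psdSqrt Q) A) (hAX : Reachable A (psdSqrt X))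
    {P S : Matrix (Fin n) (Fin n) ℝ} (hP : SolvesControlRiccati A B Q R P)
    (hS : SolvesFilterRiccati A C X V S) :
    IsMinOn J (stabilizing A B C) (lqgController A B C R V P S) := by
  have hst := lqgController_mem_stabilizing hQ hR hX hV hQA hAX hP hS
  have hH : (C * S * Cᵀ + V).PosSemidef :=
    (PosSemidef.conj' hS.1.posSemidef C).add hV.posSemidef
  have hF := riccati_schurStable hQ hR hQA hP.1.posSemidef hP.2
  set F := lqrGain A B R P with hFdef
  set L := kalmanGain A C V S with hLdef
  obtain ⟨Z, hZ⟩ := hF.exists_lyapunov (L * (C * S * Cᵀ + V) * Lᵀ)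
  -- The diagonal `x = ξ` is invariant under the closed loop, contains the driving term `(L, L)`,
  -- and is annihilated by `[F, -F]`; hence `D = E Z Eᵀ` contributes nothing.
  let E : Matrix (Fin n ⊕ Fin n) (Fin n) ℝ := fromRows 1 1
  have hME : closedLoop A B C (lqgController A B C R V P S) * E = E * (A - B * F) := by
    simp only [E, closedLoop, lqgController, observerController, Controller.CK, Controller.BK,
      Controller.AK, ← hFdef, ← hLdef, fromBlocks_mul_fromRows, fromRows_mul, Matrix.mul_one,
      Matrix.one_mul, Matrix.mul_neg]
    congr 1; abel
  have hLE : fromRows L (lqgController A B C R V P S).BK = E * L := by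
    simp only [E, fromRows_mul, Matrix.one_mul]
    rfl
  have hD : E * Z * Eᵀ = fromRows L (lqgController A B C R V P S).BK * (C * S * Cᵀ + V) *
      (fromRows L (lqgController A B C R V P S).BK)ᵀ +
      closedLoop A B C (lqgController A B C R V P S) * (E * Z * Eᵀ) *
        (closedLoop A B C (lqgController A B C R V P S))ᵀ := by
    have h1 : closedLoop A B C (lqgController A B C R V P S) * (E * Z * Eᵀ) *
        (closedLoop A B C (lqgController A B C R V P S))ᵀ =
        (closedLoop A B C (lqgController A B C R V P S) * E) * Z *
        (closedLoop A B C (lqgController A B C R V P S) * E)ᵀ := by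
      rw [transpose_mul]
      simp only [Matrix.mul_assoc]
    rw [h1, hME, hLE]
    conv_lhs => rw [hZ]
    simp only [transpose_mul, Matrix.mul_add, Matrix.add_mul, Matrix.mul_assoc]
  have h0 := hJ.eq_add hR hV hP hS hst hD
  have hGE : fromCols F (lqgController A B C R V P S).CK * (E * Z * Eᵀ) = 0 := by
    rw [← Matrix.mul_assoc, ← Matrix.mul_assoc, fromCols_mul_fromRows]
    simp [lqgController, observerController, Controller.CK, ← hFdef]
  rw [hGE, Matrix.zero_mul, Matrix.mul_zero, trace_zero, add_zero] at h0
  intro K hK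
  have hKs := mem_stabilizing_iff.1 hK
  obtain ⟨D, hD'⟩ := hKs.exists_lyapunov (fromRows L K.BK * (C * S * Cᵀ + V) * (fromRows L K.BK)ᵀ)
  have h1 := hJ.eq_add hR hV hP hS hK hD'
  have h2 := trace_posSemidef_mul_conj_nonneg
    (posDef_add_conj hR hP.1.posSemidef B).posSemidef
    (hKs.lyapunov_posSemidef hD' (PosSemidef.conj' hH _)) (fromCols F K.CK)
  change J _ ≤ J _
  rw [h0, h1]
  linarith

end Optimality

end DLQR

namespace DLQR

open Matrix Filter Topology

/-! ### Openness of the stabilizing set and differentiability of the cost. -/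

section Smoothness

attribute [local instance] Matrix.linftyOpNormedAddCommGroup Matrix.linftyOpNormedSpace
  Matrix.linftyOpNormedRing Matrix.linftyOpNormedAlgebra

/-- Stability is witnessed by one power of small norm, an open condition. The factor `‖1‖` covers
the empty index type, where it is zero. -/
theorem isOpen_schurStable {ι : Type*} [Fintype ι] [DecidableEq ι] :
    IsOpen {M : Matrix ι ι ℝ | SchurStable M} := by
  have h : {M : Matrix ι ι ℝ | SchurStable M} = ⋃ k : ℕ,
      {M : Matrix ι ι ℝ | ‖(M.map (algebraMap ℝ ℂ)) ^ k‖ * ‖(1 : Matrix ι ι ℂ)‖ < 1} := by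
    ext M
    simp only [Set.mem_ofPred_eq, Set.mem_iUnion]
    rw [← schurStable_iff_spectralRadius]
    constructor
    · intro hM
      have h1 := (spectralRadius_lt_one_iff_tendsto _).1 hM
      have h2 := (tendsto_zero_iff_norm_tendsto_zero (E := Matrix ι ι ℂ)).1 h1
      have h3 := h2.mul_const ‖(1 : Matrix ι ι ℂ)‖
      rw [zero_mul] at h3
      exact (h3.eventually (gt_mem_nhds one_pos)).exists
    · rintro ⟨k, hk⟩
      rw [spectralRadius_lt_one_iff]
      intro z hz
      by_contra hz1
      push Not at hz1
      have h1 := spectrum.norm_le_norm_mul_of_mem (spectrum.pow_mem_pow _ k hz)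
      rw [norm_pow] at h1
      linarith [one_le_pow₀ (n := k) hz1]
  rw [h]
  refine isOpen_iUnion fun k => isOpen_lt ?_ continuous_const
  have h1 : Continuous fun M : Matrix ι ι ℝ => (M.map (algebraMap ℝ ℂ)) ^ k :=
    (continuous_id.matrix_map (by fun_prop)).pow k
  exact (continuous_norm.comp h1).mul continuous_const

theorem differentiableAt_matrix {E : Type*} [NormedAddCommGroup E] [NormedSpace ℝ E]
    {ι κ : Type*} [Fintype ι] [Fintype κ] {f : E → Matrix ι κ ℝ} {x : E}
    (h : ∀ i j, DifferentiableAt ℝ (fun y => f y i j) x) : DifferentiableAt ℝ f x :=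
  differentiableAt_pi.2 fun i => differentiableAt_pi.2 fun j => h i j

theorem differentiableAt_matrix_apply {E : Type*} [NormedAddCommGroup E] [NormedSpace ℝ E]
    {ι κ : Type*} [Fintype ι] [Fintype κ] {f : E → Matrix ι κ ℝ} {x : E}
    (h : DifferentiableAt ℝ f x) (i : ι) (j : κ) : DifferentiableAt ℝ (fun y => f y i j) x :=
  differentiableAt_pi.1 (differentiableAt_pi.1 h i) j

variable {n m d : ℕ} {A : Matrix (Fin n) (Fin n) ℝ} {B : Matrix (Fin n) (Fin m) ℝ}
  {C : Matrix (Fin d) (Fin n) ℝ} {Q : Matrix (Fin n) (Fin n) ℝ} {R : Matrix (Fin m) (Fin m) ℝ}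
  {X : Matrix (Fin n) (Fin n) ℝ} {V : Matrix (Fin d) (Fin d) ℝ}

theorem differentiableAt_AK (i j : Fin n) (K₀ : Controller n m d) :
    DifferentiableAt ℝ (fun K : Controller n m d => K.AK i j) K₀ :=
  differentiableAt_matrix_apply differentiableAt_fst i j

theorem differentiableAt_BK (i : Fin n) (j : Fin d) (K₀ : Controller n m d) :
    DifferentiableAt ℝ (fun K : Controller n m d => K.BK i j) K₀ :=
  differentiableAt_matrix_apply (differentiableAt_fst.comp K₀ differentiableAt_snd) i j

theorem differentiableAt_CK (i : Fin m) (j : Fin n) (K₀ : Controller n m d) :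
    DifferentiableAt ℝ (fun K : Controller n m d => K.CK i j) K₀ :=
  differentiableAt_matrix_apply (differentiableAt_snd.comp K₀ differentiableAt_snd) i j

theorem differentiableAt_closedLoop (K₀ : Controller n m d) :
    DifferentiableAt ℝ (fun K : Controller n m d => closedLoop A B C K) K₀ := by
  refine differentiableAt_matrix ?_
  rintro (i | i) (j | j)
  · exact differentiableAt_const _
  · simp only [closedLoop, fromBlocks_apply₁₂, mul_apply]
    exact DifferentiableAt.fun_sum fun k _ => (differentiableAt_CK k j K₀).const_mul _
  · simp only [closedLoop, fromBlocks_apply₂₁, mul_apply]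
    exact DifferentiableAt.fun_sum fun k _ => (differentiableAt_BK i k K₀).mul_const _
  · exact differentiableAt_AK i j K₀

theorem differentiableAt_initMoment (K₀ : Controller n m d) :
    DifferentiableAt ℝ (fun K : Controller n m d => initMoment X V K) K₀ := by
  refine differentiableAt_matrix ?_
  rintro (i | i) (j | j)
  · exact differentiableAt_const _
  · exact differentiableAt_const _
  · exact differentiableAt_const _
  · simp only [initMoment, fromBlocks_apply₂₂, mul_apply]
    exact DifferentiableAt.fun_sum fun k _ => (DifferentiableAt.fun_sum fun l _ =>
      (differentiableAt_BK i l K₀).mul_const _).mul (differentiableAt_BK j k K₀)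

theorem differentiableAt_stageWeight (K₀ : Controller n m d) :
    DifferentiableAt ℝ (fun K : Controller n m d => stageWeight Q R K) K₀ := by
  refine differentiableAt_matrix ?_
  rintro (i | i) (j | j)
  · exact differentiableAt_const _
  · exact differentiableAt_const _
  · exact differentiableAt_const _
  · simp only [stageWeight, fromBlocks_apply₂₂, mul_apply]
    exact DifferentiableAt.fun_sum fun k _ => (DifferentiableAt.fun_sum fun l _ =>
      (differentiableAt_CK l i K₀).mul_const _).mul (differentiableAt_CK k j K₀)

theorem isOpen_stabilizing : IsOpen (stabilizing A B C) := by
  have h : stabilizing A B C = (fun K => closedLoop A B C K) ⁻¹' {M | SchurStable M} := by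
    ext K
    exact mem_stabilizing_iff
  rw [h]
  exact isOpen_schurStable.preimage
    (continuous_iff_continuousAt.2 fun K => (differentiableAt_closedLoop K).continuousAt)

/-- The solution of `S = w + a S b` depends differentiably on parameters at which the homogeneous
equation has only the trivial solution. -/
theorem exists_differentiableAt_sylvester {E 𝓐 : Type*} [NormedAddCommGroup E] [NormedSpace ℝ E]
    [NormedRing 𝓐] [NormedAlgebra ℝ 𝓐] [FiniteDimensional ℝ 𝓐] (a b w : E → 𝓐) :
    ∃ S : E → 𝓐, ∀ x, DifferentiableAt ℝ a x → DifferentiableAt ℝ b x →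
      DifferentiableAt ℝ w x → (∀ Y, Y = a x * Y * b x → Y = 0) →
        S x = w x + a x * S x * b x ∧ DifferentiableAt ℝ S x := by
  have : CompleteSpace 𝓐 := FiniteDimensional.complete ℝ 𝓐
  let Φ : E → 𝓐 →L[ℝ] 𝓐 := fun x => 1 - ContinuousLinearMap.mulLeftRight ℝ 𝓐 (a x) (b x)
  have hΦ : ∀ x Y, Φ x Y = Y - a x * Y * b x := fun x Y => rfl
  -- `Ring.inverse` is zero off the units, so a single `S` is defined everywhere and solves the
  -- equation wherever `Φ x` is invertible.
  refine ⟨fun x => Ring.inverse (Φ x) (w x), fun x ha hb hw hx => ?_⟩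
  have hunit : IsUnit (Φ x) := by
    have hinj : Function.Injective (Φ x) := by
      refine (injective_iff_map_eq_zero _).2 fun Y hY => ?_
      rw [hΦ, sub_eq_zero] at hY
      exact hx Y hY
    have hsurj : Function.Surjective (Φ x) :=
      (LinearMap.injective_iff_surjective (f := (Φ x : 𝓐 →ₗ[ℝ] 𝓐))).1 hinj
    exact ContinuousLinearMap.isUnit_iff_bijective.2 ⟨hinj, hsurj⟩
  constructor
  · have h1 : Φ x (Ring.inverse (Φ x) (w x)) = w x := by
      change (Φ x * Ring.inverse (Φ x)) _ = _
      rw [Ring.mul_inverse_cancel _ hunit]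
      rfl
    rw [hΦ, sub_eq_iff_eq_add] at h1
    exact h1
  · have h1 : DifferentiableAt ℝ Φ x := by
      refine (differentiableAt_const _).sub ?_
      exact ((ContinuousLinearMap.mulLeftRight ℝ 𝓐).differentiableAt.comp x ha).clm_apply hb
    exact ((differentiableAt_inverse hunit).comp x h1).clm_apply hw

theorem exists_differentiableAt_covariance (A : Matrix (Fin n) (Fin n) ℝ)
    (B : Matrix (Fin n) (Fin m) ℝ) (C : Matrix (Fin d) (Fin n) ℝ) (X : Matrix (Fin n) (Fin n) ℝ)
    (V : Matrix (Fin d) (Fin d) ℝ) :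
    ∃ S : Controller n m d → Matrix (Fin n ⊕ Fin n) (Fin n ⊕ Fin n) ℝ,
      ∀ K ∈ stabilizing A B C,
        S K = initMoment X V K + closedLoop A B C K * S K * (closedLoop A B C K)ᵀ ∧
        DifferentiableAt ℝ S K := by
  obtain ⟨S, hS⟩ := exists_differentiableAt_sylvester
    (fun K : Controller n m d => closedLoop A B C K) (fun K => (closedLoop A B C K)ᵀ)
    (fun K => initMoment X V K)
  refine ⟨S, fun K hK => ?_⟩
  have hK' := mem_stabilizing_iff.1 hK
  exact hS K (differentiableAt_closedLoop K)
    (differentiableAt_matrix fun i j =>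
      differentiableAt_matrix_apply (differentiableAt_closedLoop K) j i)
    (differentiableAt_initMoment K) fun Y hY => hK'.eq_zero_of_eq_mul_mul hK'.transpose hY

/-- Continuity of the covariance is all that the gradient computation needs. -/
theorem exists_continuousAt_covariance (A : Matrix (Fin n) (Fin n) ℝ)
    (B : Matrix (Fin n) (Fin m) ℝ) (C : Matrix (Fin d) (Fin n) ℝ) (X : Matrix (Fin n) (Fin n) ℝ)
    (V : Matrix (Fin d) (Fin d) ℝ) :
    ∃ S : Controller n m d → Matrix (Fin n ⊕ Fin n) (Fin n ⊕ Fin n) ℝ,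
      ∀ K ∈ stabilizing A B C,
        S K = initMoment X V K + closedLoop A B C K * S K * (closedLoop A B C K)ᵀ ∧
        ContinuousAt S K := by
  obtain ⟨S, hS⟩ := exists_differentiableAt_covariance A B C X V
  exact ⟨S, fun K hK => ⟨(hS K hK).1, (hS K hK).2.continuousAt⟩⟩

theorem IsGramianCost.differentiableAt {J : Controller n m d → ℝ}
    (hJ : IsGramianCost A B C Q R X V J) {K : Controller n m d} (hK : K ∈ stabilizing A B C) :
    DifferentiableAt ℝ J K := by
  obtain ⟨S, hS⟩ := exists_differentiableAt_covariance A B C X V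
  have h1 : DifferentiableAt ℝ (fun K => (stageWeight Q R K * S K).trace) K := by
    simp only [trace, diag, mul_apply]
    exact DifferentiableAt.fun_sum fun i _ => DifferentiableAt.fun_sum fun j _ =>
      (differentiableAt_matrix_apply (differentiableAt_stageWeight K) i j).mul
      (differentiableAt_matrix_apply (hS K hK).2 j i)
  refine h1.congr_of_eventuallyEq ?_
  filter_upwards [isOpen_stabilizing.mem_nhds hK] with K' hK'
  exact hJ K' hK' _ (hS K' hK').1

/-- A minimizer of the cost over the stabilizing controllers is stationary. -/
theorem IsGramianCost.isStationary_of_isMinOn {J : Controller n m d → ℝ}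
    (hJ : IsGramianCost A B C Q R X V J) {K : Controller n m d} (hK : K ∈ stabilizing A B C)
    (hmin : IsMinOn J (stabilizing A B C) K) : IsStationary J K := by
  have h1 : IsLocalMin J K := hmin.isLocalMin (isOpen_stabilizing.mem_nhds hK)
  obtain ⟨J', hJ'⟩ := hJ.differentiableAt hK
  have h2 : J' = 0 := h1.hasFDerivAt_eq_zero hJ'
  rw [h2] at hJ'
  exact hJ'

theorem IsStationary.hasDerivAt_line {J : Controller n m d → ℝ} {K : Controller n m d}
    (h : IsStationary J K) (E : Controller n m d) :
    HasDerivAt (fun t : ℝ => J (K + t • E)) 0 0 := by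
  have h1 : HasDerivAt (fun t : ℝ => K + t • E) E 0 := by
    have := ((hasDerivAt_id (0 : ℝ)).smul_const E).const_add K
    rwa [one_smul] at this
  have h2 : HasFDerivAt J (0 : Controller n m d →L[ℝ] ℝ) (K + (0 : ℝ) • E) := by
    simpa using! h
  exact h2.comp_hasDerivAt (0 : ℝ) h1

end Smoothness

end DLQR

namespace DLQR

open Matrix Filter Topology

/-! ### First-order optimality conditions. -/

section Gradient

variable {n m d : ℕ} {A : Matrix (Fin n) (Fin n) ℝ} {B : Matrix (Fin n) (Fin m) ℝ}
  {C : Matrix (Fin d) (Fin n) ℝ} {Q : Matrix (Fin n) (Fin n) ℝ} {R : Matrix (Fin m) (Fin m) ℝ}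
  {X : Matrix (Fin n) (Fin n) ℝ} {V : Matrix (Fin d) (Fin d) ℝ}

/-- The directional derivative of the cost at a stationary point, expressed by the closed-loop
Gramians `S` and `P`, vanishes. -/
theorem IsGramianCost.directional_eq_zero {J : Controller n m d → ℝ}
    (hJ : IsGramianCost A B C Q R X V J) {K : Controller n m d} (hK : K ∈ stabilizing A B C)
    (hstat : IsStationary J K) {S P : Matrix (Fin n ⊕ Fin n) (Fin n ⊕ Fin n) ℝ}
    (hS : S = initMoment X V K + closedLoop A B C K * S * (closedLoop A B C K)ᵀ)
    (hP : P = stageWeight Q R K + (closedLoop A B C K)ᵀ * P * closedLoop A B C K)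
    (E : Controller n m d) :
    ((fromBlocks 0 0 0 (E.CKᵀ * R * K.CK + K.CKᵀ * R * E.CK) +
        ((fromBlocks 0 (B * E.CK) (E.BK * C) E.AK)ᵀ * P * closedLoop A B C K +
          (closedLoop A B C K)ᵀ * P * fromBlocks 0 (B * E.CK) (E.BK * C) E.AK)) * S).trace +
      (P * fromBlocks 0 0 0 (E.BK * V * K.BKᵀ + K.BK * V * E.BKᵀ)).trace = 0 := by
  obtain ⟨Sf, hSf⟩ := exists_continuousAt_covariance A B C X V
  set M := closedLoop A B C K with hM
  obtain ⟨D, hD⟩ : ∃ D : Matrix (Fin n ⊕ Fin n) (Fin n ⊕ Fin n) ℝ,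
    D = fromBlocks 0 (B * E.CK) (E.BK * C) E.AK := ⟨_, rfl⟩
  obtain ⟨Q₁, hQ₁⟩ : ∃ Q₁ : Matrix (Fin n ⊕ Fin n) (Fin n ⊕ Fin n) ℝ,
    Q₁ = fromBlocks 0 0 0 (E.CKᵀ * R * K.CK + K.CKᵀ * R * E.CK) := ⟨_, rfl⟩
  obtain ⟨Q₂, hQ₂⟩ : ∃ Q₂ : Matrix (Fin n ⊕ Fin n) (Fin n ⊕ Fin n) ℝ,
    Q₂ = fromBlocks 0 0 0 (E.CKᵀ * R * E.CK) := ⟨_, rfl⟩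
  obtain ⟨W₁, hW₁⟩ : ∃ W₁ : Matrix (Fin n ⊕ Fin n) (Fin n ⊕ Fin n) ℝ,
    W₁ = fromBlocks 0 0 0 (E.BK * V * K.BKᵀ + K.BK * V * E.BKᵀ) := ⟨_, rfl⟩
  obtain ⟨W₂, hW₂⟩ : ∃ W₂ : Matrix (Fin n ⊕ Fin n) (Fin n ⊕ Fin n) ℝ,
    W₂ = fromBlocks 0 0 0 (E.BK * V * E.BKᵀ) := ⟨_, rfl⟩
  rw [← hD, ← hQ₁, ← hW₁]
  have eB : ∀ t : ℝ, (K + t • E).BK = K.BK + t • E.BK := fun _ => rfl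
  have eC : ∀ t : ℝ, (K + t • E).CK = K.CK + t • E.CK := fun _ => rfl
  have eM : ∀ t : ℝ, closedLoop A B C (K + t • E) = M + t • D := by
    intro t
    rw [hM, hD, closedLoop, closedLoop, fromBlocks_smul, fromBlocks_add]
    simp [eB, eC, Matrix.mul_add, Matrix.add_mul]
  have eQ : ∀ t : ℝ, stageWeight Q R (K + t • E) = stageWeight Q R K + t • (Q₁ + t • Q₂) := by
    intro t
    rw [hQ₁, hQ₂, stageWeight, stageWeight, fromBlocks_smul, fromBlocks_add, fromBlocks_smul,
      fromBlocks_add]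
    simp only [eC, transpose_add, transpose_smul, Matrix.mul_add,
      Matrix.add_mul, Matrix.smul_mul, Matrix.mul_smul, smul_add, smul_zero, add_zero]
    congr 1
    abel
  have eW : ∀ t : ℝ, initMoment X V (K + t • E) = initMoment X V K + t • (W₁ + t • W₂) := by
    intro t
    rw [hW₁, hW₂, initMoment, initMoment, fromBlocks_smul, fromBlocks_add, fromBlocks_smul,
      fromBlocks_add]
    simp only [eB, transpose_add, transpose_smul, Matrix.mul_add,
      Matrix.add_mul, Matrix.smul_mul, Matrix.mul_smul, smul_add, smul_zero, add_zero]
    congr 1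
    abel
  have hline : Continuous fun t : ℝ => K + t • E := by fun_prop
  have hline0 : K + (0 : ℝ) • E = K := by simp
  have hSK : Sf K = S := (mem_stabilizing_iff.1 hK).lyapunov_unique (hSf K hK).1 hS
  have hScont : ContinuousAt (fun t : ℝ => Sf (K + t • E)) 0 := by
    refine ContinuousAt.comp (g := Sf) (f := fun t : ℝ => K + t • E) ?_ hline.continuousAt
    rw [hline0]
    exact (hSf K hK).2
  -- `g` is the exact difference quotient along the line. Pairing the perturbed covariance with the
  -- unperturbed `P` avoids differentiating the covariance: `t` factors out algebraically.
  let g : ℝ → ℝ := fun t =>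
    ((Q₁ + (Dᵀ * P * M + Mᵀ * P * D) + t • (Q₂ + Dᵀ * P * D)) * Sf (K + t • E)).trace +
      (P * (W₁ + t • W₂)).trace
  have hg : ContinuousAt g 0 := by
    have h1 : Continuous fun p : ℝ × Matrix (Fin n ⊕ Fin n) (Fin n ⊕ Fin n) ℝ =>
        ((Q₁ + (Dᵀ * P * M + Mᵀ * P * D) + p.1 • (Q₂ + Dᵀ * P * D)) * p.2).trace +
      (P * (W₁ + p.1 • W₂)).trace := by fun_prop
    exact ContinuousAt.comp (f := fun t : ℝ => (t, Sf (K + t • E))) h1.continuousAt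
      (continuousAt_id.prodMk hScont)
  have hmem : ∀ᶠ t : ℝ in 𝓝 0, K + t • E ∈ stabilizing A B C := by
    refine hline.continuousAt.eventually_mem ?_
    rw [hline0]
    exact isOpen_stabilizing.mem_nhds hK
  have hexp : ∀ t : ℝ, K + t • E ∈ stabilizing A B C → J (K + t • E) = J K + t * g t := by
    intro t ht
    have h1 := (hSf _ ht).1
    have h2 := hJ _ ht _ h1
    have h3 := hJ K hK _ hS
    rw [← lyapunov_trace_duality hP hS] at h3
    set S' := Sf (K + t • E) with hS'
    rw [eM, eW] at h1
    rw [eQ] at h2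
    have h4 : (P * S').trace = (P * (initMoment X V K + t • (W₁ + t • W₂))).trace +
        ((M + t • D)ᵀ * P * (M + t • D) * S').trace := by
      have h5 : ((M + t • D)ᵀ * P * (M + t • D) * S').trace =
          (P * ((M + t • D) * S' * (M + t • D)ᵀ)).trace := by
        rw [Matrix.mul_assoc, Matrix.mul_assoc, trace_mul_comm]
        simp only [Matrix.mul_assoc]
      rw [h5, ← trace_add, ← Matrix.mul_add, ← h1]
    have h6 : ((stageWeight Q R K + Mᵀ * P * M) * S').trace = (P * S').trace := by rw [← hP]
    have h7 : (M + t • D)ᵀ * P * (M + t • D) =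
        Mᵀ * P * M + t • (Dᵀ * P * M + Mᵀ * P * D) + t • t • (Dᵀ * P * D) := by
      simp only [transpose_add, transpose_smul, Matrix.add_mul, Matrix.mul_add, Matrix.smul_mul,
        Matrix.mul_smul, smul_add]
      abel
    rw [h7] at h4
    simp only [g, Matrix.add_mul, Matrix.mul_add, trace_add, Matrix.smul_mul, Matrix.mul_smul,
      trace_smul, smul_eq_mul, smul_add, ← hS'] at h2 h3 h4 h6 ⊢
    linarith
  have hder : HasDerivAt (fun t : ℝ => J (K + t • E)) (g 0) 0 := by
    rw [hasDerivAt_iff_tendsto_slope_zero]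
    refine (hg.tendsto.mono_left nhdsWithin_le_nhds).congr' ?_
    filter_upwards [nhdsWithin_le_nhds hmem, self_mem_nhdsWithin] with t ht ht0
    rw [zero_add, hexp t ht, hline0, add_sub_cancel_left, smul_eq_mul, inv_mul_cancel_left₀ ht0]
  have h0 := hder.unique (hstat.hasDerivAt_line E)
  simpa only [g, zero_smul, add_zero, hSK] using h0

/-- The first-order optimality conditions in block form. -/
theorem IsGramianCost.stationary_blocks {J : Controller n m d → ℝ}
    (hJ : IsGramianCost A B C Q R X V J) (hR : Rᵀ = R) (hV : Vᵀ = V)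
    {K : Controller n m d} (hK : K ∈ stabilizing A B C)
    (hstat : IsStationary J K) {S P Y : Matrix (Fin n ⊕ Fin n) (Fin n ⊕ Fin n) ℝ}
    (hS : S = initMoment X V K + closedLoop A B C K * S * (closedLoop A B C K)ᵀ)
    (hP : P = stageWeight Q R K + (closedLoop A B C K)ᵀ * P * closedLoop A B C K)
    (hSs : Sᵀ = S) (hPs : Pᵀ = P) (hY : Y = P * closedLoop A B C K * S) :
    Y.toBlocks₂₂ = 0 ∧ Y.toBlocks₂₁ * Cᵀ + P.toBlocks₂₂ * K.BK * V = 0 ∧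
      Bᵀ * Y.toBlocks₁₂ + R * K.CK * S.toBlocks₂₂ = 0 := by
  have key := hJ.directional_eq_zero hK hstat hS hP
  set M := closedLoop A B C K with hM
  -- The two terms are transposes of each other under the trace, as `S` and `P` are symmetric.
  have htr : ∀ D : Matrix (Fin n ⊕ Fin n) (Fin n ⊕ Fin n) ℝ,
      ((Dᵀ * P * M + Mᵀ * P * D) * S).trace = 2 * (Dᵀ * Y).trace := by
    intro D
    have h1 : (Mᵀ * P * D * S).trace = (Dᵀ * P * M * S).trace := by
      rw [← trace_transpose]
      simp only [transpose_mul, transpose_transpose, hSs, hPs]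
      rw [trace_mul_comm]
      simp only [Matrix.mul_assoc]
    rw [Matrix.add_mul, trace_add, h1, hY]
    simp only [Matrix.mul_assoc]
    ring
  have hYb := (fromBlocks_toBlocks Y).symm
  have hSb := (fromBlocks_toBlocks S).symm
  have hPb := (fromBlocks_toBlocks P).symm
  have hS22 : (S.toBlocks₂₂)ᵀ = S.toBlocks₂₂ := by
    ext i j
    exact congrFun (congrFun hSs (Sum.inr i)) (Sum.inr j)
  have hP22 : (P.toBlocks₂₂)ᵀ = P.toBlocks₂₂ := by
    ext i j
    exact congrFun (congrFun hPs (Sum.inr i)) (Sum.inr j)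
  have hblk : ∀ a b c e : Matrix (Fin n) (Fin n) ℝ, (fromBlocks a b c e).trace = a.trace + e.trace :=
    fun a b c e => by simp [trace, Fintype.sum_sum_type]
  have htr0 : ∀ {k l : ℕ} (Z : Matrix (Fin k) (Fin l) ℝ),
      (∀ E : Matrix (Fin k) (Fin l) ℝ, (Eᵀ * Z).trace = 0) → Z = 0 := by
    intro k l Z h
    have := h Z
    rw [← conjTranspose_eq_transpose_of_trivial] at this
    exact trace_conjTranspose_mul_self_eq_zero_iff.1 this
  -- The three conditions come from perturbing `A_K`, `B_K` and `C_K` separately.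
  refine ⟨htr0 _ fun E => ?_, htr0 _ fun E => ?_, htr0 _ fun E => ?_⟩
  · have h1 := key (E, 0, 0)
    simp only [Controller.AK, Controller.BK, Controller.CK, Matrix.mul_zero, Matrix.zero_mul,
      transpose_zero, add_zero, fromBlocks_zero, zero_add, trace_zero] at h1
    rw [htr, hYb, fromBlocks_transpose, fromBlocks_multiply, hblk] at h1
    simpa using h1
  · have h1 := key (0, E, 0)
    simp only [Controller.AK, Controller.BK, Controller.CK, Matrix.mul_zero, Matrix.zero_mul,
      transpose_zero, add_zero, fromBlocks_zero, zero_add] at h1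
    rw [htr, hYb, fromBlocks_transpose, fromBlocks_multiply, hblk, hPb, fromBlocks_multiply,
      hblk] at h1
    have h2 : (P.toBlocks₂₂ * (E * V * K.2.1ᵀ)).trace =
        (P.toBlocks₂₂ * (K.2.1 * V * Eᵀ)).trace := by
      rw [← trace_transpose]
      simp only [transpose_mul, transpose_transpose, hP22, hV]
      rw [trace_mul_comm]
      simp only [Matrix.mul_assoc]
    have h3 : (P.toBlocks₂₂ * (K.2.1 * V * Eᵀ)).trace = (Eᵀ * (P.toBlocks₂₂ * K.2.1 * V)).trace := by
      rw [trace_mul_comm Eᵀ]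
      simp only [Matrix.mul_assoc]
    have h4 : (Cᵀ * Eᵀ * Y.toBlocks₂₁).trace = (Eᵀ * (Y.toBlocks₂₁ * Cᵀ)).trace := by
      rw [Matrix.mul_assoc, trace_mul_comm]
      simp only [Matrix.mul_assoc]
    simp only [transpose_zero, Matrix.zero_mul, zero_add, Matrix.mul_zero, trace_zero, add_zero,
      transpose_mul, Matrix.mul_add, trace_add, h2, h3, h4] at h1 ⊢
    linarith
  · have h1 := key (0, 0, E)
    simp only [Controller.AK, Controller.BK, Controller.CK, Matrix.mul_zero, Matrix.zero_mul,
      transpose_zero, add_zero, fromBlocks_zero, trace_zero] at h1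
    rw [Matrix.add_mul, trace_add, htr, hYb, fromBlocks_transpose, fromBlocks_multiply, hblk, hSb,
      fromBlocks_multiply, hblk] at h1
    have h2 : (K.2.2ᵀ * R * E * S.toBlocks₂₂).trace = (Eᵀ * R * K.2.2 * S.toBlocks₂₂).trace := by
      rw [← trace_transpose]
      simp only [transpose_mul, transpose_transpose, hS22, hR]
      rw [trace_mul_comm]
      simp only [Matrix.mul_assoc]
    have h3 : (Eᵀ * (R * K.2.2 * S.toBlocks₂₂)).trace = (Eᵀ * R * K.2.2 * S.toBlocks₂₂).trace := by
      simp only [Matrix.mul_assoc]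
    have h4 : (Eᵀ * Bᵀ * Y.toBlocks₁₂).trace = (Eᵀ * (Bᵀ * Y.toBlocks₁₂)).trace := by
      simp only [Matrix.mul_assoc]
    simp only [transpose_zero, Matrix.zero_mul, zero_add, trace_zero, add_zero,
      transpose_mul, Matrix.mul_add, Matrix.add_mul, trace_add, h2, h3, h4] at h1 ⊢
    linarith

end Gradient

end DLQR

namespace DLQR

open Matrix Filter Topology

/-! ### Minimal stationary controllers are transforms of the observer-based one. -/

section Stationary

variable {n m d : ℕ} {A : Matrix (Fin n) (Fin n) ℝ} {B : Matrix (Fin n) (Fin m) ℝ}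
  {C : Matrix (Fin d) (Fin n) ℝ} {Q : Matrix (Fin n) (Fin n) ℝ} {R : Matrix (Fin m) (Fin m) ℝ}
  {X : Matrix (Fin n) (Fin n) ℝ} {V : Matrix (Fin d) (Fin d) ℝ}

/-- If the controller is reachable then the covariance of its state is positive definite. -/
theorem covariance_toBlocks₂₂_posDef (hV : V.PosDef) {K : Controller n m d}
    (hK : Reachable K.AK K.BK) {S : Matrix (Fin n ⊕ Fin n) (Fin n ⊕ Fin n) ℝ} (hSp : S.PosSemidef)
    (hS : S = initMoment X V K + closedLoop A B C K * S * (closedLoop A B C K)ᵀ) :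
    S.toBlocks₂₂.PosDef := by
  rw [reachable_iff_observable] at hK
  have hquad : ∀ v : Fin n → ℝ, Sum.elim (0 : Fin n → ℝ) v ⬝ᵥ (S *ᵥ Sum.elim (0 : Fin n → ℝ) v) =
      v ⬝ᵥ (S.toBlocks₂₂ *ᵥ v) := by
    intro v
    conv_lhs => rw [← fromBlocks_toBlocks S, fromBlocks_mulVec]
    rw [sumElim_dotProduct_sumElim]
    simp
  -- If `S` kills `(0, v)`, then `V ≻ 0` forces `B_Kᵀ v = 0`, so the transposed closed loop maps
  -- `(0, v)` to `(0, A_Kᵀ v)`, again in the kernel. Reachability then ends the argument.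
  have hstep : ∀ v : Fin n → ℝ, S *ᵥ Sum.elim (0 : Fin n → ℝ) v = 0 →
      K.BKᵀ *ᵥ v = 0 ∧ S *ᵥ Sum.elim (0 : Fin n → ℝ) (K.AKᵀ *ᵥ v) = 0 := by
    intro v hv
    have h0 : Sum.elim (0 : Fin n → ℝ) v ⬝ᵥ (S *ᵥ Sum.elim (0 : Fin n → ℝ) v) = 0 := by rw [hv, dotProduct_zero]
    have hW : Sum.elim (0 : Fin n → ℝ) v ⬝ᵥ (initMoment X V K *ᵥ Sum.elim (0 : Fin n → ℝ) v) =
        (K.BKᵀ *ᵥ v) ⬝ᵥ (V *ᵥ (K.BKᵀ *ᵥ v)) := by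
      rw [initMoment, fromBlocks_mulVec, sumElim_dotProduct_sumElim, ← dotProduct_conj_mulVec]
      simp
    have hM := dotProduct_conj_mulVec S (closedLoop A B C K)ᵀ (Sum.elim (0 : Fin n → ℝ) v)
    rw [transpose_transpose] at hM
    rw [hS, add_mulVec, dotProduct_add, hW, hM] at h0
    have h1 := (posSemidef_iff_real.1 hV.posSemidef).2 (K.BKᵀ *ᵥ v)
    have h2 := (posSemidef_iff_real.1 hSp).2 ((closedLoop A B C K)ᵀ *ᵥ Sum.elim (0 : Fin n → ℝ) v)
    have h3 : K.BKᵀ *ᵥ v = 0 := PosDef.mulVec_eq_zero hV (by linarith)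
    refine ⟨h3, ?_⟩
    have h4 := PosSemidef.mulVec_eq_zero hSp
      (x := (closedLoop A B C K)ᵀ *ᵥ Sum.elim (0 : Fin n → ℝ) v) (by linarith)
    have h5 : (closedLoop A B C K)ᵀ *ᵥ Sum.elim (0 : Fin n → ℝ) v = Sum.elim (0 : Fin n → ℝ) (K.AKᵀ *ᵥ v) := by
      rw [closedLoop, fromBlocks_transpose, fromBlocks_mulVec, transpose_mul]
      simp [← mulVec_mulVec, h3]
    rwa [h5] at h4
  have hpsd : S.toBlocks₂₂.PosSemidef := hSp.submatrix Sum.inr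
  refine PosSemidef.posDef_of_ker hpsd fun v hv => observable_iff.1 hK v fun t _ => ?_
  have h0 : S *ᵥ Sum.elim (0 : Fin n → ℝ) v = 0 :=
    PosSemidef.mulVec_eq_zero hSp (by rw [hquad, hv, dotProduct_zero])
  have h1 : ∀ t : ℕ, S *ᵥ Sum.elim (0 : Fin n → ℝ) ((K.AKᵀ ^ t) *ᵥ v) = 0 := by
    intro t
    induction t with
    | zero => simpa using h0
    | succ t ih =>
      rw [pow_succ', ← mulVec_mulVec]
      exact (hstep _ ih).2
  exact (hstep _ (h1 t)).1

/-- The filtering half of the first-order conditions: a stationary controller with nondegenerate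
Gramians carries a Kalman filter. Here `N` and `M` are the coordinate changes given by the Gramians
and `S₀` is the covariance of the estimation error. -/
theorem kalman_of_stationary (hX : X.PosSemidef) (hV : V.PosDef) (hAX : Reachable A (psdSqrt X))
    {K : Controller n m d} {S₀ : Matrix (Fin n) (Fin n) ℝ} (hS₀ : SolvesFilterRiccati A C X V S₀)
    {S P Y : Matrix (Fin n ⊕ Fin n) (Fin n ⊕ Fin n) ℝ} (hSp : S.PosSemidef)
    (hS : S = initMoment X V K + closedLoop A B C K * S * (closedLoop A B C K)ᵀ)
    (hY : Y = P * closedLoop A B C K * S)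
    (hS22 : S.toBlocks₂₂.PosDef) (hP22 : P.toBlocks₂₂.PosDef)
    (hY22 : Y.toBlocks₂₂ = 0) (hY21 : Y.toBlocks₂₁ * Cᵀ + P.toBlocks₂₂ * K.BK * V = 0)
    {N M : Matrix (Fin n) (Fin n) ℝ} (hN : N = -(P.toBlocks₂₂⁻¹ * P.toBlocks₂₁))
    (hM : M = S.toBlocks₁₂ * S.toBlocks₂₂⁻¹) :
    N * M = 1 ∧ K.BK = N * kalmanGain A C V S₀ ∧
      K.AK = N * A * M + N * B * K.CK - K.BK * C * M := by
  obtain ⟨S11, hS11⟩ : ∃ Z, Z = S.toBlocks₁₁ := ⟨_, rfl⟩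
  obtain ⟨S12, hS12⟩ : ∃ Z, Z = S.toBlocks₁₂ := ⟨_, rfl⟩
  obtain ⟨S22, hS22'⟩ : ∃ Z, Z = S.toBlocks₂₂ := ⟨_, rfl⟩
  obtain ⟨P11, hP11⟩ : ∃ Z, Z = P.toBlocks₁₁ := ⟨_, rfl⟩
  obtain ⟨P12, hP12⟩ : ∃ Z, Z = P.toBlocks₁₂ := ⟨_, rfl⟩
  obtain ⟨P21, hP21⟩ : ∃ Z, Z = P.toBlocks₂₁ := ⟨_, rfl⟩
  obtain ⟨P22, hP22'⟩ : ∃ Z, Z = P.toBlocks₂₂ := ⟨_, rfl⟩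
  have hSs := PosSemidef.transpose_eq hSp
  have hS21 : S.toBlocks₂₁ = S12ᵀ := by
    rw [hS12]
    ext i j
    exact congrFun (congrFun hSs (Sum.inr i)) (Sum.inl j) |>.symm
  have hSb : S = fromBlocks S11 S12 S12ᵀ S22 := by
    rw [← hS21, hS11, hS12, hS22', fromBlocks_toBlocks]
  have hPb : P = fromBlocks P11 P12 P21 P22 := by
    rw [hP11, hP12, hP21, hP22', fromBlocks_toBlocks]
  rw [← hS22'] at hS22 hM
  rw [← hP22'] at hP22 hN hY21
  rw [← hP21] at hN
  rw [← hS12] at hM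
  have uS : IsUnit S22.det := (isUnit_iff_isUnit_det _).1 hS22.isUnit
  have uP : IsUnit P22.det := (isUnit_iff_isUnit_det _).1 hP22.isUnit
  have hS12M : S12 = M * S22 := by rw [hM, nonsing_inv_mul_cancel_right _ _ uS]
  have hP21N : P21 = -(P22 * N) := by
    rw [hN, Matrix.mul_neg, neg_neg, mul_nonsing_inv_cancel_left _ _ uP]
  have hS22s : S22ᵀ = S22 := PosDef.transpose_eq hS22
  obtain ⟨a, ha⟩ : ∃ Z, Z = K.AK := ⟨_, rfl⟩
  obtain ⟨b, hb⟩ : ∃ Z, Z = K.BK := ⟨_, rfl⟩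
  obtain ⟨c, hc⟩ : ∃ Z, Z = K.CK := ⟨_, rfl⟩
  rw [← ha, ← hb, ← hc]
  rw [← hb] at hY21
  have hYb : Y = fromBlocks P11 P12 P21 P22 * (fromBlocks A (B * c) (b * C) a *
      fromBlocks S11 S12 S12ᵀ S22) := by
    rw [hY, hSb, hPb, closedLoop, ← ha, ← hb, ← hc, Matrix.mul_assoc]
  rw [fromBlocks_multiply, fromBlocks_multiply] at hYb
  rw [hYb, toBlocks_fromBlocks₂₂, hP21N] at hY22
  rw [hYb, toBlocks_fromBlocks₂₁, hP21N] at hY21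
  have cancel : ∀ {k : ℕ} (Z : Matrix (Fin n) (Fin k) ℝ), P22 * Z = 0 → Z = 0 := by
    intro k Z hZ
    rw [← nonsing_inv_mul_cancel_left _ Z uP, hZ, Matrix.mul_zero]
  -- `eqA` and `eqB` are the stationarity conditions in `A_K` and `B_K` after cancelling the
  -- invertible `P22`.
  have eqA : b * C * S12 + a * S22 = N * (A * S12 + B * c * S22) := by
    refine sub_eq_zero.1 (cancel _ ?_)
    rw [← hY22]
    simp only [Matrix.mul_sub, Matrix.neg_mul, Matrix.mul_assoc]
    abel
  have eqB : (b * C * S11 + a * S12ᵀ) * Cᵀ + b * V = N * (A * S11 + B * c * S12ᵀ) * Cᵀ := by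
    refine sub_eq_zero.1 (cancel _ ?_)
    rw [← hY21]
    simp only [Matrix.mul_sub, Matrix.mul_add, Matrix.add_mul, Matrix.neg_mul, Matrix.mul_assoc]
    abel
  have hLyap : fromBlocks S11 S12 S12ᵀ S22 = fromBlocks X 0 0 (b * V * bᵀ) +
      fromBlocks A (B * c) (b * C) a * fromBlocks S11 S12 S12ᵀ S22 *
        (fromBlocks A (B * c) (b * C) a)ᵀ := by
    rw [← hSb, ha, hb, hc]
    exact hS
  rw [fromBlocks_multiply, fromBlocks_transpose, fromBlocks_multiply, fromBlocks_add,
    fromBlocks_inj, zero_add] at hLyap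
  obtain ⟨l11, l12, -, l22⟩ := hLyap
  -- Multiplying the `(1,2)` Lyapunov block by `N` and inserting `eqA` and `eqB` reproduces the
  -- `(2,2)` block.
  have hNS : N * S12 = S22 := by
    have h1 : b * V * bᵀ = N * (A * S11 + B * c * S12ᵀ) * Cᵀ * bᵀ -
        (b * C * S11 + a * S12ᵀ) * Cᵀ * bᵀ := by
      rw [← eqB, Matrix.add_mul, add_sub_cancel_left]
    refine (congrArg (N * ·) l12).trans (Eq.trans ?_ l22.symm)
    change N * (_ + _) = _
    rw [eqA, h1, transpose_mul b C, Matrix.mul_add]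
    simp only [← Matrix.mul_assoc]
    abel
  have hNM : N * M = 1 := by rw [hM, ← Matrix.mul_assoc, hNS, mul_nonsing_inv _ uS]
  have hMN : M * N = 1 := mul_eq_one_comm.1 hNM
  have hA : a = N * A * M + N * B * c - b * C * M := by
    rw [eq_sub_iff_add_eq]
    have h1 := congrArg (· * S22⁻¹) eqA
    simp only [hS12M, Matrix.add_mul, Matrix.mul_add, ← Matrix.mul_assoc,
      mul_nonsing_inv_cancel_right _ _ uS] at h1
    rw [add_comm, h1]
  -- The Schur complement of `S22`, that is, the covariance of the error of the estimate `M ξ` of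
  -- `x`.
  set S₁ := S11 - M * S22 * Mᵀ with hS₁
  have hS₁p : S₁.PosSemidef := by
    have h1 := PosSemidef.conj' hSp (fromCols 1 (-M) : Matrix (Fin n) (Fin n ⊕ Fin n) ℝ)
    convert! h1 using 1
    rw [hSb, fromCols_mul_fromBlocks, transpose_fromCols, fromCols_mul_fromRows, hS₁, hS12M,
      transpose_mul, hS22s]
    simp only [Matrix.one_mul, Matrix.mul_one, transpose_one, transpose_neg, Matrix.neg_mul,
      Matrix.mul_neg, Matrix.add_mul, neg_add, neg_neg, Matrix.mul_assoc]
    abel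
  -- Substituting `hA` into `eqB` leaves the Kalman gain equation for `S₁`.
  have hB : b * (C * S₁ * Cᵀ + V) = N * (A * S₁ * Cᵀ) := by
    have h1 : a * S22 = N * A * M * S22 + N * B * c * S22 - b * C * M * S22 := by
      conv_lhs => rw [hA]
      simp only [Matrix.sub_mul, Matrix.add_mul]
    have h2 : S12ᵀ = S22 * Mᵀ := by rw [hS12M, transpose_mul, hS22s]
    rw [h2, ← Matrix.mul_assoc a, h1] at eqB
    rw [hS₁]
    rw [← sub_eq_zero] at eqB ⊢
    rw [← eqB]
    simp only [Matrix.sub_mul, Matrix.add_mul, Matrix.mul_sub, Matrix.mul_add, Matrix.mul_assoc]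
    abel
  have hHp : (C * S₁ * Cᵀ + V).PosDef := by
    rw [add_comm]
    exact hV.add_posSemidef (PosSemidef.conj' hS₁p C)
  have uH : IsUnit (C * S₁ * Cᵀ + V).det := (isUnit_iff_isUnit_det _).1 hHp.isUnit
  obtain ⟨L, hL⟩ : ∃ L, L = kalmanGain A C V S₁ := ⟨_, rfl⟩
  have hLH : L * (C * S₁ * Cᵀ + V) = A * S₁ * Cᵀ := by
    rw [hL, kalmanGain, nonsing_inv_mul_cancel_right _ _ uH]
  have hbL : b = N * L := by
    rw [← mul_nonsing_inv_cancel_right _ b uH, hB, ← hLH, ← Matrix.mul_assoc,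
      mul_nonsing_inv_cancel_right _ _ uH]
  have hLb : M * b = L := by rw [hbL, ← Matrix.mul_assoc, hMN, Matrix.one_mul]
  -- `F` is the predictor part of the recursion `M a = F - L C M` for the estimate `M ξ`. Its
  -- contribution `F S22 Fᵀ` is common to `r22` and `r11`, and their difference is the filter
  -- Riccati equation.
  obtain ⟨F, hF⟩ : ∃ F, F = A * M + B * c := ⟨_, rfl⟩
  have hFa : M * a = F - L * C * M := by
    rw [hA, hF, Matrix.mul_sub, Matrix.mul_add]
    simp only [← Matrix.mul_assoc, hMN, hLb, Matrix.one_mul]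
  have hT12 : S12ᵀ = S22 * Mᵀ := by rw [hS12M, transpose_mul, hS22s]
  have r22 : M * S22 * Mᵀ = L * (C * S₁ * Cᵀ + V) * Lᵀ + F * S22 * Fᵀ := by
    have h1 : M * S22 * Mᵀ = (M * b) * V * (M * b)ᵀ +
        (((M * b) * C * S11 + (M * a) * S12ᵀ) * ((M * b) * C)ᵀ +
          ((M * b) * C * S12 + (M * a) * S22) * (M * a)ᵀ) := by
      conv_lhs => rw [l22]
      simp only [transpose_mul, Matrix.mul_add, Matrix.add_mul, Matrix.mul_assoc]
    have h2 : S11 = S₁ + M * S22 * Mᵀ := by rw [hS₁, sub_add_cancel]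
    rw [h1, hLb, hFa, hT12, hS12M, h2]
    simp only [transpose_mul, transpose_sub, Matrix.mul_add, Matrix.add_mul, Matrix.sub_mul,
      Matrix.mul_sub, Matrix.mul_assoc]
    abel
  have r11 : S11 = X + A * S₁ * Aᵀ + F * S22 * Fᵀ := by
    conv_lhs => rw [l11]
    have h2 : S11 = S₁ + M * S22 * Mᵀ := by rw [hS₁, sub_add_cancel]
    rw [hT12, hS12M, h2, hF]
    simp only [transpose_mul, transpose_add, Matrix.mul_add, Matrix.add_mul, Matrix.mul_assoc]
    abel
  have hric : S₁ = riccatiMap Aᵀ Cᵀ X V S₁ := by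
    rw [riccatiMap_eq hV hS₁p]
    have h1 : (lqrGain Aᵀ Cᵀ V S₁)ᵀ = L := by rw [hL, kalmanGain_eq hV hS₁p]
    have h2 : lqrGain Aᵀ Cᵀ V S₁ = Lᵀ := by rw [← h1, transpose_transpose]
    rw [h1, h2, transpose_transpose, transpose_transpose, add_comm V]
    conv_lhs => rw [hS₁, r22, r11]
    abel
  have hS₀' := solvesFilterRiccati_iff.1 hS₀
  rw [reachable_iff_observable, psdSqrt_transpose] at hAX
  have heq : S₁ = S₀ := riccati_unique hX hV hAX hS₁p hric hS₀'.1.posSemidef hS₀'.2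
  exact ⟨hNM, by rw [hbL, hL, heq], hA⟩

/-- Every minimal stationary controller is a similarity transform of the optimal observer-based
controller. -/
theorem IsGramianCost.eq_similarity_of_isStationary {J : Controller n m d → ℝ}
    (hJ : IsGramianCost A B C Q R X V J)
    (hQ : Q.PosSemidef) (hR : R.PosDef) (hX : X.PosSemidef)
    (hV : V.PosDef) (hQA : Observable (psdSqrt Q) A) (hAX : Reachable A (psdSqrt X))
    {P₀ S₀ : Matrix (Fin n) (Fin n) ℝ} (hP₀ : SolvesControlRiccati A B Q R P₀)
    (hS₀ : SolvesFilterRiccati A C X V S₀) {K : Controller n m d} (hK : K ∈ stabilizing A B C)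
    (hmin : K.IsMinimal) (hstat : IsStationary J K) :
    ∃ T : GL (Fin n) ℝ, K = (lqgController A B C R V P₀ S₀).similarity T := by
  have hKs := mem_stabilizing_iff.1 hK
  obtain ⟨S, hS⟩ := hKs.exists_lyapunov (initMoment X V K)
  obtain ⟨P, hP⟩ := hKs.transpose.exists_lyapunov (stageWeight Q R K)
  have hSp : S.PosSemidef := by
    refine hKs.lyapunov_posSemidef hS ?_
    rw [initMoment_eq_stageWeight]
    exact stageWeight_posSemidef hX hV.posSemidef _
  have hPp : P.PosSemidef :=
    hKs.transpose.lyapunov_posSemidef hP (stageWeight_posSemidef hQ hR.posSemidef _)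
  -- For the dual system `P` plays the role of the covariance, so observability of the controller
  -- yields definiteness of its lower right block.
  have hPd : P = initMoment Q R (dualController K) +
      closedLoop Aᵀ Cᵀ Bᵀ (dualController K) * P * (closedLoop Aᵀ Cᵀ Bᵀ (dualController K))ᵀ := by
    rw [closedLoop_dual, initMoment_eq_stageWeight]
    exact hP
  have hP' := hP
  rw [transpose_transpose] at hP'
  have hSs := PosSemidef.transpose_eq hSp
  have hPs := PosSemidef.transpose_eq hPp
  have hS22 : S.toBlocks₂₂.PosDef := covariance_toBlocks₂₂_posDef hV hmin.2 hSp hS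
  have hP22 : P.toBlocks₂₂.PosDef :=
    covariance_toBlocks₂₂_posDef (K := dualController K) hR
      (observable_iff_reachable.1 hmin.1) hPp hPd
  obtain ⟨Y, hY⟩ : ∃ Y, Y = P * closedLoop A B C K * S := ⟨_, rfl⟩
  obtain ⟨hY22, hY21, hY12⟩ := hJ.stationary_blocks (PosDef.transpose_eq hR)
    (PosDef.transpose_eq hV) hK hstat hS hP' hSs hPs hY
  obtain ⟨hNM, hBK, hAK⟩ := kalman_of_stationary (A := A) hX hV hAX hS₀ hSp hS hY hS22 hP22
    hY22 hY21 rfl rfl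
  have hdualY : Yᵀ = S * closedLoop Aᵀ Cᵀ Bᵀ (dualController K) * P := by
    rw [closedLoop_dual, hY, transpose_mul, transpose_mul, hSs, hPs, Matrix.mul_assoc]
  have hdS₀ : SolvesFilterRiccati Aᵀ Bᵀ Q R P₀ := by
    rw [solvesFilterRiccati_iff, transpose_transpose, transpose_transpose]
    exact hP₀
  have hdQA : Reachable Aᵀ (psdSqrt Q) := by
    rw [reachable_iff_observable, transpose_transpose, psdSqrt_transpose]
    exact hQA
  have hdY22 : (Yᵀ).toBlocks₂₂ = 0 := by
    have h1 : (Yᵀ).toBlocks₂₂ = (Y.toBlocks₂₂)ᵀ := rfl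
    rw [h1, hY22, transpose_zero]
  have hdY21 : (Yᵀ).toBlocks₂₁ * (Bᵀ)ᵀ + S.toBlocks₂₂ * (dualController K).BK * R = 0 := by
    have h1 : (Yᵀ).toBlocks₂₁ = (Y.toBlocks₁₂)ᵀ := rfl
    have h2 := congrArg transpose hY12
    rw [transpose_zero, transpose_add, transpose_mul, transpose_mul, transpose_mul,
      PosDef.transpose_eq hR, PosDef.transpose_eq hS22, ← Matrix.mul_assoc] at h2
    rw [h1]
    exact h2
  -- Only the gain is taken from the dual filter: it determines `C_K`, while `A_K` is already
  -- expressed through `B_K` and `C_K`.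
  obtain ⟨-, hCK, -⟩ := kalman_of_stationary (A := Aᵀ) (B := Cᵀ) (C := Bᵀ) (K := dualController K)
    hQ hR hdQA hdS₀ hPp hPd hdualY hP22 hS22 hdY22 hdY21 rfl rfl
  set N := -(P.toBlocks₂₂⁻¹ * P.toBlocks₂₁)
  set M := S.toBlocks₁₂ * S.toBlocks₂₂⁻¹ with hM
  have hS21 : S.toBlocks₂₁ = S.toBlocks₁₂ᵀ := by
    ext i j
    exact congrFun (congrFun hSs (Sum.inr i)) (Sum.inl j) |>.symm
  have hCK' : K.CK = -(lqrGain A B R P₀ * M) := by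
    have h1 := congrArg transpose hCK
    have h2 : (dualController K).BKᵀ = K.CK := transpose_transpose _
    rw [h2, transpose_mul, transpose_neg, transpose_mul, transpose_nonsing_inv,
      PosDef.transpose_eq hS22, hS21, transpose_transpose, ← hM,
      kalmanGain_eq hR hP₀.1.posSemidef, transpose_transpose, transpose_transpose,
      transpose_transpose, Matrix.mul_neg] at h1
    exact h1
  let T : GL (Fin n) ℝ := ⟨N, M, hNM, mul_eq_one_comm.1 hNM⟩
  refine ⟨T, ?_⟩
  have hT : (T : Matrix (Fin n) (Fin n) ℝ) = N := rfl
  have hT' : ((T⁻¹ : GL (Fin n) ℝ) : Matrix (Fin n) (Fin n) ℝ) = M := rfl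
  refine Prod.ext ?_ (Prod.ext ?_ ?_)
  · change K.AK = N * (A - B * lqrGain A B R P₀ - kalmanGain A C V S₀ * C) * M
    rw [hAK, hCK', hBK]
    simp only [Matrix.mul_sub, Matrix.sub_mul, Matrix.mul_neg, Matrix.mul_assoc]
    abel
  · exact hBK
  · change K.CK = -lqrGain A B R P₀ * M
    rw [hCK', Matrix.neg_mul]

end Stationary

end DLQR

/-! ### The main theorem. -/

theorem theorem3 {n m d : ℕ}
    (A : Matrix (Fin n) (Fin n) ℝ) (B : Matrix (Fin n) (Fin m) ℝ) (C : Matrix (Fin d) (Fin n) ℝ)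
    (Q : Matrix (Fin n) (Fin n) ℝ) (R : Matrix (Fin m) (Fin m) ℝ)
    (hQ : Q.PosSemidef) (hR : R.PosDef)
    (hAB : DLQR.Reachable A B) (hCA : DLQR.Observable C A)
    (hQA : DLQR.Observable (DLQR.psdSqrt Q) A)
    {Ω : Type*} [MeasurableSpace Ω] (μ : MeasureTheory.Measure Ω)
    [MeasureTheory.IsProbabilityMeasure μ]
    (x₀ : Ω → Fin n → ℝ) (s : Ω → Fin d → ℝ)
    (hx₀ : MeasureTheory.MemLp x₀ 2 μ) (hs : MeasureTheory.MemLp s 2 μ)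
    (X₁₁ : Matrix (Fin n) (Fin n) ℝ) (V : Matrix (Fin d) (Fin d) ℝ)
    (hX₁₁ : DLQR.secondMoment μ x₀ x₀ = X₁₁) (hV : DLQR.secondMoment μ s s = V)
    (hx₀s : DLQR.secondMoment μ x₀ s = 0)
    (hAX : DLQR.Reachable A (DLQR.psdSqrt X₁₁)) (hVpos : V.PosDef) :
    (∃! P : Matrix (Fin n) (Fin n) ℝ, DLQR.SolvesControlRiccati A B Q R P) ∧
    (∃! S : Matrix (Fin n) (Fin n) ℝ, DLQR.SolvesFilterRiccati A C X₁₁ V S) ∧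
    ∀ P S : Matrix (Fin n) (Fin n) ℝ,
      DLQR.SolvesControlRiccati A B Q R P → DLQR.SolvesFilterRiccati A C X₁₁ V S →
      -- minimal stabilizing stationary points are globally optimal
      (∀ K ∈ DLQR.stabilizing A B C, K.IsMinimal →
        DLQR.IsStationary (DLQR.cost A B C Q R μ x₀ s) K →
        IsMinOn (DLQR.cost A B C Q R μ x₀ s) (DLQR.stabilizing A B C) K) ∧
      -- they are exactly the similarity transforms of the observer-based controller, which has to
      -- be minimal for such points to exist at all
      (∀ K : DLQR.Controller n m d,
        (K ∈ DLQR.stabilizing A B C ∧ K.IsMinimal ∧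
          DLQR.IsStationary (DLQR.cost A B C Q R μ x₀ s) K) ↔
        ((DLQR.observerController A B C (DLQR.lqrGain A B R P)
            (DLQR.kalmanGain A C V S)).IsMinimal ∧
          ∃ T : GL (Fin n) ℝ, K = DLQR.Controller.similarity T
            (DLQR.observerController A B C (DLQR.lqrGain A B R P) (DLQR.kalmanGain A C V S)))) ∧
      -- minimal or not, all these transforms are stabilizing, stationary and globally optimal
      (∀ T : GL (Fin n) ℝ,
        DLQR.Controller.similarity T (DLQR.observerController A B C (DLQR.lqrGain A B R P)
            (DLQR.kalmanGain A C V S)) ∈ DLQR.stabilizing A B C ∧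
        DLQR.IsStationary (DLQR.cost A B C Q R μ x₀ s)
          (DLQR.Controller.similarity T (DLQR.observerController A B C (DLQR.lqrGain A B R P)
            (DLQR.kalmanGain A C V S))) ∧
        IsMinOn (DLQR.cost A B C Q R μ x₀ s) (DLQR.stabilizing A B C)
          (DLQR.Controller.similarity T (DLQR.observerController A B C (DLQR.lqrGain A B R P)
            (DLQR.kalmanGain A C V S)))) := by
  have hQR := hR.posSemidef
  have hX : X₁₁.PosSemidef := hX₁₁ ▸ DLQR.secondMoment_posSemidef hx₀
  have hFA : DLQR.Observable (DLQR.psdSqrt X₁₁) A.transpose := by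
    rwa [DLQR.reachable_iff_observable, DLQR.psdSqrt_transpose] at hAX
  -- The expectation is first a trace against the value matrix `P`; duality rewrites it through the
  -- covariance.
  have hJ : DLQR.IsGramianCost A B C Q R X₁₁ V (DLQR.cost A B C Q R μ x₀ s) := by
    intro K hK S hS
    obtain ⟨P, hP⟩ := (DLQR.mem_stabilizing_iff.1 hK).transpose.exists_lyapunov
      (DLQR.stageWeight Q R K)
    rw [Matrix.transpose_transpose] at hP
    rw [DLQR.cost_eq_trace hQ hQR hx₀ hs hx₀s hK hP, hX₁₁, hV,
      DLQR.lyapunov_trace_duality hP hS]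
  refine ⟨DLQR.existsUnique_solvesControlRiccati hQ hR hAB hQA, ?_, fun P S hP hS => ?_⟩
  · simp only [DLQR.solvesFilterRiccati_iff]
    exact DLQR.existsUnique_solvesControlRiccati hX hVpos (DLQR.observable_iff_reachable.1 hCA) hFA
  set K₀ : DLQR.Controller n m d :=
    DLQR.observerController A B C (DLQR.lqrGain A B R P) (DLQR.kalmanGain A C V S)
  have hopt : ∀ T : GL (Fin n) ℝ, K₀.similarity T ∈ DLQR.stabilizing A B C ∧
      DLQR.IsStationary (DLQR.cost A B C Q R μ x₀ s) (K₀.similarity T) ∧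
      IsMinOn (DLQR.cost A B C Q R μ x₀ s) (DLQR.stabilizing A B C) (K₀.similarity T) := by
    intro T
    have h1 : K₀.similarity T ∈ DLQR.stabilizing A B C := DLQR.similarity_mem_stabilizing
      (DLQR.lqgController_mem_stabilizing hQ hR hX hVpos hQA hAX hP hS) T
    have h2 : IsMinOn (DLQR.cost A B C Q R μ x₀ s) (DLQR.stabilizing A B C)
        (K₀.similarity T) := by
      intro K hK
      have h3 := hJ.isMinOn_lqgController hQ hR hX hVpos hQA hAX hP hS hK
      change DLQR.cost A B C Q R μ x₀ s _ ≤ _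
      rw [DLQR.cost_similarity]
      exact h3
    exact ⟨h1, hJ.isStationary_of_isMinOn h1 h2, h2⟩
  have hform : ∀ K ∈ DLQR.stabilizing A B C, K.IsMinimal →
      DLQR.IsStationary (DLQR.cost A B C Q R μ x₀ s) K →
      ∃ T : GL (Fin n) ℝ, K = K₀.similarity T := fun K hK hmin hstat =>
    hJ.eq_similarity_of_isStationary hQ hR hX hVpos hQA hAX hP hS hK hmin hstat
  refine ⟨fun K hK hmin hstat => ?_, fun K => ⟨?_, ?_⟩, hopt⟩
  · obtain ⟨T, rfl⟩ := hform K hK hmin hstat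
    exact (hopt T).2.2
  · rintro ⟨hK, hmin, hstat⟩
    obtain ⟨T, rfl⟩ := hform K hK hmin hstat
    refine ⟨?_, T, rfl⟩
    -- Minimality is carried back to the observer-based controller, so it fails for every transform
    -- if it fails there.
    have h1 := hmin.similarity T⁻¹
    rwa [DLQR.similarity_similarity_inv] at h1
  · rintro ⟨hmin, T, rfl⟩
    exact ⟨(hopt T).1, hmin.similarity T, (hopt T).2.1⟩
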